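/- Setting. Let $d\ge 1$, $\mathcal X=[0,1]^d$, $\mathcal Y=\{-1,1\}$, let $\mathrm P$ be a probability measure on $\mathcal X\times\mathcal Y$ with marginal $\mathrm P_X$ and posterior probability $\eta(x)=\mathrm P(Y=1\mid X=x)$. Let $L(y,t)=\mathbf 1_{\{y\ne t\}}$ be the classification loss, $(L\circ g)(x,y)=L(y,g(x))$, $\mathcal R(g)=\int L\circ g\,d\mathrm P$, $\mathcal R^*$ the infimum of $\mathcal R(f)$ over measurable $f:\mathcal X\to\mathcal Y$, and let $f^*$ be any measurable $f^*:\mathcal X\to\mathcal Y$ with $\mathcal R(f^*)=\mathcal R^*$. Assume that $\mathrm P$ has noise exponent $\alpha\in[0,\infty]$ with constant $c_\alpha>0$: $\mathrm P_X(\{x:|2\eta(x)-1|\le h\})\le c_\alpha h^\alpha$ for all $h\ge 0$ (for $\alpha=\infty$ this means that the probability is $0$ for $0\le h<1$). Put $\vartheta=\alpha/(1+\alpha)$, with $\vartheta=1$ if $\alpha=\infty$. Trees. A splitting policy $Z$ prescribes, for each $i=0,1,2,\dots$, which of the $i+1$ cells present after $i$ splits is split next, in which coordinate, and in which proportion $s\in(0,1)$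 its side is cut; starting from the single cell $\mathcal X$ it produces after $p$ splits a partition $A_0,\dots,A_p$ of $\mathcal X$ into boxes (a common face of two boxes belongs to the upper one). Let $\mathcal T_{Z,p}$ be the set of functions $\sum_{j=0}^p c_j\mathbf 1_{A_j}$ with $c_j\in\{-1,1\}$. Fix $k\ge1$ policies $Z_1,\dots,Z_k$, let $\mathcal T=\bigcup_{\ell=1}^k\bigcup_{p\ge0}\mathcal T_{Z_\ell,p}$ and, for $g\in\mathcal T$, let $p(g)$ be the least $p$ with $g\in\bigcup_\ell\mathcal T_{Z_\ell,p}$. For $\lambda>0$ let $r^*=\inf_{g\in\mathcal T}\bigl(\lambda p(g)^2+\mathcal R(g)-\mathcal R^*\bigr)$, and for $r>r^*$ $$\mathcal G_r=\{g\in\mathcal T:\lambda p(g)^2+\mathcal R(g)-\mathcal R^*\le r\},\qquad \mathcal H_r=\{L\circ g-L\circ f^*:g\in\mathcal G_r\}.$$ For a sample $D=(z_1,\dots,z_n)$, $n\ge 1$, let $\mathrm{Rad}_D(\mathcal H_r,n)=\mathbb E_\varepsilon\sup_{h\in\mathcal H_r}\bigl|\frac1n\sum_{i=1}^n\varepsilon_ih(z_i)\bigr|$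 with independent $\varepsilon_i$ uniform on $\{-1,1\}$. For $\delta\in(0,1)$ let $c_{d,\delta}=\bigl(\frac{18d}{e\delta}\bigr)^{1/(2\delta)}$. Claim. There are constants $c_{\delta,1},c_{\delta,2}>0$ depending only on $\delta$, and $V>0$ depending only on $\alpha$ and $c_\alpha$, such that for all $d,\mathrm P,f^*,\alpha,c_\alpha,k,Z_1,\dots,Z_k,\lambda,n$ as above, all $\delta\in(0,1)$ and all $r>r^*$ with $c_{d,\delta}\,(r/\lambda)^{1/(4\delta)}\ge 1$ (in particular whenever $r\ge\lambda$), the function $D\mapsto\mathrm{Rad}_D(\mathcal H_r,n)$ is $\mathrm P^n$-integrable and $$\mathbb E_{D\sim\mathrm P^n}\mathrm{Rad}_D(\mathcal H_r,n)\le\max\Bigl\{c_{\delta,1}\,c_{d,\delta}^{\delta}\,V^{\frac{1-\delta}2}\lambda^{-\frac14}r^{\frac{2\vartheta-2\vartheta\delta+1}4}n^{-\frac12},\;c_{\delta,2}\,c_{d,\delta}^{\frac{2\delta}{1+\delta}}\lambda^{-\frac1{2+2\delta}}r^{\frac1{2+2\delta}}n^{-\frac1{1+\delta}}\Bigr\}.$$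 -/

import Mathlib

open MeasureTheory ProbabilityTheory
open scoped ENNReal

noncomputable section

namespace BestScoredForest

/-! ### The classification problem on the unit cube -/

/-- The feature space `𝒳 = [0,1]^d`. The label space `𝒴 = {-1, 1}` is `ℤˣ`. -/
abbrev Cube (d : ℕ) : Type := Fin d → unitInterval

instance : MeasurableSingletonClass ℤˣ :=
  ⟨fun a => ⟨{(a : ℤ)}, MeasurableSet.singleton _, by ext b; simp [Units.ext_iff]⟩⟩

/-- The classification loss `L(y, t) = 1_{y ≠ t}`. -/
def loss (y t : ℤˣ) : ℝ := if y ≠ t then 1 else 0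

/-- `L ∘ g`, that is, `(x, y) ↦ L(y, g(x))`. -/
def lossOf {d : ℕ} (g : Cube d → ℤˣ) : Cube d × ℤˣ → ℝ :=
  fun z => loss z.2 (g z.1)

/-- The risk of a decision function. -/
def risk {d : ℕ} (P : Measure (Cube d × ℤˣ)) (g : Cube d → ℤˣ) : ℝ :=
  ∫ z, lossOf g z ∂P

/-- The Bayes risk, the infimum of the risks of all measurable decision functions. -/
def bayesRisk {d : ℕ} (P : Measure (Cube d × ℤˣ)) : ℝ :=
  ⨅ f : {f : Cube d → ℤˣ // Measurable f}, risk P f.1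

/-- A Bayes decision function: measurable, and its risk is the Bayes risk. -/
def IsBayesDecision {d : ℕ} (P : Measure (Cube d × ℤˣ)) (f : Cube d → ℤˣ) : Prop :=
  Measurable f ∧ risk P f = bayesRisk P

/-- The posterior probability `η(x) = P(Y = 1 | X = x)`. -/
def posterior {d : ℕ} (P : Measure (Cube d × ℤˣ)) [IsFiniteMeasure P] (x : Cube d) : ℝ :=
  (P.condKernel x).real {1}

/-- `P` has noise exponent `α ∈ [0, ∞]` with constant `c`:
`P_X (|2η - 1| ≤ h) ≤ c h ^ α` for all `h ≥ 0`. For `α = ∞` we use `h ^ ∞ = 0` for `0 ≤ h < 1`,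
and no condition is imposed for `h ≥ 1`. -/
def HasNoiseExponent {d : ℕ} (P : Measure (Cube d × ℤˣ)) [IsFiniteMeasure P]
    (α : ℝ≥0∞) (c : ℝ) : Prop :=
  (α ≠ ∞ → ∀ h : ℝ, 0 ≤ h → P.fst.real {x | |2 * posterior P x - 1| ≤ h} ≤ c * h ^ α.toReal) ∧
  (α = ∞ → ∀ h : ℝ, 0 ≤ h → h < 1 → P.fst.real {x | |2 * posterior P x - 1| ≤ h} = 0)

/-- `ϑ = α / (1 + α)`, with value `1` at `α = ∞`. -/
def varExponent (α : ℝ≥0∞) : ℝ :=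
  if α = ∞ then 1 else α.toReal / (1 + α.toReal)

/-! ### Axis-parallel tree partitions -/

/-- A value of the partition variable: at the step leading from `i` to `i + 1` splits, `leaf i` is
the leaf to be split, among the `i + 1` present leaves, `dim i` is the dimension that is split, and
`ratio i ∈ (0, 1)` is the length of the newly generated leaf in that dimension divided by the length
of the leaf being split. -/
structure SplittingPolicy (d : ℕ) where
  leaf : (i : ℕ) → Fin (i + 1)
  dim : ℕ → Fin d
  ratio : ℕ → Set.Ioo (0 : ℝ) 1

/-- An axis-parallel box, given by its lower and its upper corner. -/
structure Box (d : ℕ) where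
  lo : Fin d → ℝ
  hi : Fin d → ℝ

namespace Box

variable {d : ℕ}

/-- The part of the unit cube occupied by a box. A common face of two boxes is given to the upper
one, so that the cells of a tree really form a partition; faces in the boundary of the cube belong
to the boxes they bound. -/
def toSet (B : Box d) : Set (Cube d) :=
  {x | ∀ i, B.lo i ≤ (x i : ℝ) ∧ ((x i : ℝ) < B.hi i ∨ ((x i : ℝ) = 1 ∧ B.hi i = 1))}

/-- The point at which dimension `i` is cut for the ratio `s`. -/
def cut (B : Box d) (i : Fin d) (s : ℝ) : ℝ := B.lo i + s * (B.hi i - B.lo i)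

/-- The newly generated leaf. -/
def lower (B : Box d) (i : Fin d) (s : ℝ) : Box d :=
  ⟨B.lo, Function.update B.hi i (B.cut i s)⟩

/-- The rest of the leaf that is split. -/
def upper (B : Box d) (i : Fin d) (s : ℝ) : Box d :=
  ⟨Function.update B.lo i (B.cut i s), B.hi⟩

end Box

namespace SplittingPolicy

variable {d : ℕ}

/-- The `p + 1` boxes after `p` splits. -/
def boxes (Z : SplittingPolicy d) : (p : ℕ) → Fin (p + 1) → Box d
  | 0 => fun _ => ⟨fun _ => 0, fun _ => 1⟩
  | p + 1 =>
    Fin.snoc (α := fun _ => Box d)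
      (Function.update (Z.boxes p) (Z.leaf p)
        ((Z.boxes p (Z.leaf p)).upper (Z.dim p) (Z.ratio p)))
      ((Z.boxes p (Z.leaf p)).lower (Z.dim p) (Z.ratio p))

/-- The `j`-th cell of the partition `𝒜_{Z,p}`. -/
def cell (Z : SplittingPolicy d) (p : ℕ) (j : Fin (p + 1)) : Set (Cube d) :=
  (Z.boxes p j).toSet

/-- `𝒯_{Z,p}`: the functions `∑ j, c_j 1_{A_j}` with `c_j ∈ {-1, 1}`, where `A_0, …, A_p` are the
cells after `p` splits. -/
def trees (Z : SplittingPolicy d) (p : ℕ) : Set (Cube d → ℤˣ) :=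
  {g | ∃ c : Fin (p + 1) → ℤˣ, ∀ x,
    (g x : ℤ) = ∑ j, (Z.cell p j).indicator (fun _ => (c j : ℤ)) x}

end SplittingPolicy

/-! ### The localized classes -/

section Classes

variable {d k : ℕ}

/-- `𝒯_{Z_t} = ⋃_ℓ ⋃_p 𝒯_{Z_ℓ,p}` for the `k` candidate policies `Z_1, …, Z_k`. -/
def treeClass (Z : Fin k → SplittingPolicy d) : Set (Cube d → ℤˣ) :=
  {g | ∃ ℓ p, g ∈ (Z ℓ).trees p}

/-- The number of splits `p(g)` of `g ∈ 𝒯_{Z_t}`: the least one with which `g` can be produced. -/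
def numSplits (Z : Fin k → SplittingPolicy d) (g : Cube d → ℤˣ) : ℕ :=
  sInf {p | ∃ ℓ, g ∈ (Z ℓ).trees p}

/-- The regularized excess risk `λ p(g)² + R(g) - R*`. -/
def regExcessRisk (P : Measure (Cube d × ℤˣ)) (Z : Fin k → SplittingPolicy d) (lam : ℝ)
    (g : Cube d → ℤˣ) : ℝ :=
  lam * (numSplits Z g : ℝ) ^ 2 + risk P g - bayesRisk P

/-- `r* = inf_{g ∈ 𝒯_{Z_t}} λ p(g)² + R(g) - R*`. -/
def rStar (P : Measure (Cube d × ℤˣ)) (Z : Fin k → SplittingPolicy d) (lam : ℝ) : ℝ :=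
  ⨅ g : treeClass Z, regExcessRisk P Z lam g.1

/-- `𝒢_r`. -/
def localTrees (P : Measure (Cube d × ℤˣ)) (Z : Fin k → SplittingPolicy d) (lam r : ℝ) :
    Set (Cube d → ℤˣ) :=
  {g | g ∈ treeClass Z ∧ regExcessRisk P Z lam g ≤ r}

/-- `ℋ_r = {L ∘ g - L ∘ f* : g ∈ 𝒢_r}`. -/
def lossDiffs (P : Measure (Cube d × ℤˣ)) (Z : Fin k → SplittingPolicy d)
    (fstar : Cube d → ℤˣ) (lam r : ℝ) : Set (Cube d × ℤˣ → ℝ) :=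
  {h | ∃ g ∈ localTrees P Z lam r, h = lossOf g - lossOf fstar}

end Classes

/-- The empirical Rademacher average of `F` at the sample `D`: the expectation, over uniformly
distributed signs `ε ∈ {-1, 1}^n` (the law of `n` independent Rademacher variables), of
`sup_{f ∈ F} |n⁻¹ ∑ ε_i f(D_i)|`. -/
def rademacher {S : Type*} {n : ℕ} (F : Set (S → ℝ)) (D : Fin n → S) : ℝ :=
  (2 ^ n : ℝ)⁻¹ * ∑ ε : Fin n → ℤˣ,
    ⨆ f : F, |(n : ℝ)⁻¹ * ∑ i, ((ε i : ℤ) : ℝ) * f.1 (D i)|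

/-- `c_{d,δ} = (18 d / (e δ)) ^ (1 / (2 δ))`. -/
def entropyConst (d : ℕ) (δ : ℝ) : ℝ :=
  (18 * (d : ℝ) / (Real.exp 1 * δ)) ^ (1 / (2 * δ))

end BestScoredForest

end

noncomputable section

namespace BestScoredForest

/-! ### Guillotine trees -/

/-! The bound comes from local Rademacher analysis: entropy, chaining, and a self-bounding
inequality for the expected average.

Entropy. Excess risk is nonnegative, so a tree in the localized class has at most `√(r/lam)` splits.
Forgetting the policies, it is a guillotine tree with that many inner nodes, which is why `k` and
the policies do not enter the bound. A recursion on the root split (`card_traces_le`) counts the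
subsets of a finite sample that such trees cut out. If trees differ pairwise on a fraction `κ` of
the sample, then about `2 log N / κ` randomly chosen sample points still tell all `N` of them apart
(`exists_separating`). Inserting this number of points into the count gives `log N ≲ p log (d/κ)`,
and trading the logarithm for a power gives `log (2N) ≤ 4 A κ^(-δ)` with `A = 18d/(eδ) · √(r/lam)`.
The hypothesis on `entropyConst` says exactly that `A ≥ 1`, which absorbs the additive constants.

Chaining. Massart's lemma along dyadic nets (`rademacher_le_chaining`) bounds the empirical average
by `C √(A/n) σ^(1-δ)`, where `σ²` is the largest empirical second moment in the class at the given
sample.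

Self-bounding. By Jensen the expected average `R` is at most `C √(A/n) (E σ²)^((1-δ)/2)`.
Symmetrization gives `E σ² ≤ v + 2R`, where `v` bounds the true second moments and the noise
exponent yields `v` of order `r^ϑ`. The two terms of the maximum are the solutions of this
inequality when `v` dominates and when `R` dominates (`le_max_of_le_mul_rpow`). -/

/-- `g` is computed by a binary tree with `p` inner nodes, each of which compares one coordinate
with a threshold. -/
inductive IsGuillotine {d : ℕ} : ℕ → (Cube d → ℤˣ) → Prop
  | leaf (c : ℤˣ) : IsGuillotine 0 (fun _ => c)
  | node (i : Fin d) (s : ℝ) {p q : ℕ} {g h : Cube d → ℤˣ} :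
      IsGuillotine p g → IsGuillotine q h →
        IsGuillotine (p + q + 1) (fun x => if (x i : ℝ) < s then g x else h x)

theorem IsGuillotine.measurable {d p : ℕ} {g : Cube d → ℤˣ} (hg : IsGuillotine p g) :
    Measurable g := by
  induction hg with
  | leaf c => exact measurable_const
  | node i s _ _ h1 h2 =>
    refine Measurable.ite ?_ h1 h2
    exact measurableSet_lt (measurable_subtype_coe.comp (measurable_pi_apply i)) measurable_const

/-- A vacuous comparison `x₀ < 0` pads the tree, so all trees of a localized class can be given the
same number of inner nodes. This needs a coordinate, hence `0 < d`. -/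
theorem IsGuillotine.succ {d p : ℕ} (hd : 0 < d) {g : Cube d → ℤˣ} (hg : IsGuillotine p g) :
    IsGuillotine (p + 1) g := by
  have h := IsGuillotine.node ⟨0, hd⟩ 0 (IsGuillotine.leaf 1) hg
  have e : (fun x : Cube d => if (x ⟨0, hd⟩ : ℝ) < 0 then (1 : ℤˣ) else g x) = g := by
    funext x
    rw [if_neg (not_lt.2 (x ⟨0, hd⟩).2.1)]
  rw [e] at h
  simpa using h

theorem IsGuillotine.mono {d p q : ℕ} (hd : 0 < d) (hpq : p ≤ q) {g : Cube d → ℤˣ}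
    (hg : IsGuillotine p g) : IsGuillotine q g := by
  induction hpq with
  | refl => exact hg
  | step _ ih => exact ih.succ hd

namespace Box

variable {d : ℕ} {B : Box d} {i : Fin d} {s : ℝ}

theorem cut_mem (h : B.lo i < B.hi i) (hs : s ∈ Set.Ioo (0 : ℝ) 1) :
    B.lo i < B.cut i s ∧ B.cut i s < B.hi i := by
  unfold cut
  constructor
  · nlinarith [hs.1, mul_pos hs.1 (sub_pos.2 h)]
  · nlinarith [hs.2, mul_pos (sub_pos.2 hs.2) (sub_pos.2 h)]

theorem mem_lower (h : B.lo i < B.hi i) (h1 : B.hi i ≤ 1) (hs : s ∈ Set.Ioo (0 : ℝ) 1)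
    (x : Cube d) : x ∈ (B.lower i s).toSet ↔ x ∈ B.toSet ∧ (x i : ℝ) < B.cut i s := by
  obtain ⟨ha, hb⟩ := cut_mem h hs
  constructor
  · intro hx
    have hi := hx i
    simp only [lower, Function.update_self] at hi
    have hlt : (x i : ℝ) < B.cut i s := by
      rcases hi.2 with h2 | h2
      · exact h2
      -- The closed-face clause would force the cut to equal 1, but it lies strictly below `B.hi i ≤
      -- 1`.
      · linarith [h2.2]
    refine ⟨fun j => ?_, hlt⟩
    by_cases hj : j = i
    · subst hj
      exact ⟨hi.1, Or.inl (hlt.trans hb)⟩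
    · have := hx j
      simpa only [lower, Function.update_of_ne hj] using this
  · rintro ⟨hx, hlt⟩ j
    by_cases hj : j = i
    · subst hj
      simp only [lower, Function.update_self]
      exact ⟨(hx j).1, Or.inl hlt⟩
    · simpa only [lower, Function.update_of_ne hj] using hx j

theorem mem_upper (h : B.lo i < B.hi i) (hs : s ∈ Set.Ioo (0 : ℝ) 1)
    (x : Cube d) : x ∈ (B.upper i s).toSet ↔ x ∈ B.toSet ∧ ¬ (x i : ℝ) < B.cut i s := by
  obtain ⟨ha, hb⟩ := cut_mem h hs
  constructor
  · intro hx
    have hi := hx i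
    simp only [upper, Function.update_self] at hi
    refine ⟨fun j => ?_, not_lt.2 hi.1⟩
    by_cases hj : j = i
    · subst hj
      exact ⟨ha.le.trans hi.1, hi.2⟩
    · have := hx j
      simpa only [upper, Function.update_of_ne hj] using this
  · rintro ⟨hx, hlt⟩ j
    by_cases hj : j = i
    · subst hj
      simp only [upper, Function.update_self]
      exact ⟨not_lt.1 hlt, (hx j).2⟩
    · simpa only [upper, Function.update_of_ne hj] using hx j

end Box

namespace SplittingPolicy

variable {d : ℕ} (Z : SplittingPolicy d)

/-- Cells never degenerate, so each cut is strictly interior and a lower piece can never reach the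
face `x i = 1`. The half-open convention then gives every point exactly one cell. -/
theorem boxes_lo_lt_hi (p : ℕ) : ∀ (j : Fin (p + 1)) (i : Fin d),
    (Z.boxes p j).lo i < (Z.boxes p j).hi i ∧ (Z.boxes p j).hi i ≤ 1 := by
  induction p with
  | zero => intro j i; simp [boxes]
  | succ p ih =>
    have hc := Box.cut_mem (ih (Z.leaf p) (Z.dim p)).1 (Z.ratio p).2
    have hl := ih (Z.leaf p)
    intro j
    refine Fin.lastCases ?_ (fun j => ?_) j
    · intro i
      simp only [boxes, Fin.snoc_last, Box.lower]
      by_cases hi : i = Z.dim p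
      · subst hi
        simp only [Function.update_self]
        exact ⟨hc.1, hc.2.le.trans (hl _).2⟩
      · simp only [Function.update_of_ne hi]
        exact hl i
    · intro i
      simp only [boxes, Fin.snoc_castSucc]
      by_cases hj : j = Z.leaf p
      · subst hj
        simp only [Function.update_self, Box.upper]
        by_cases hi : i = Z.dim p
        · subst hi
          simp only [Function.update_self]
          exact ⟨hc.2, (hl _).2⟩
        · simp only [Function.update_of_ne hi]
          exact hl i
      · rw [Function.update_of_ne hj]
        exact ih j i

open Classical in
/-- The index of the cell after `p` splits that contains a given point. -/
def cellIndex : (p : ℕ) → Cube d → Fin (p + 1)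
  | 0, _ => 0
  | p + 1, x =>
    if cellIndex p x = Z.leaf p then
      if (x (Z.dim p) : ℝ) < (Z.boxes p (Z.leaf p)).cut (Z.dim p) (Z.ratio p) then Fin.last _
      else (Z.leaf p).castSucc
    else (cellIndex p x).castSucc

theorem mem_cell_iff (p : ℕ) (x : Cube d) : ∀ j, x ∈ Z.cell p j ↔ Z.cellIndex p x = j := by
  induction p with
  | zero =>
    intro j
    have : j = 0 := Fin.fin_one_eq_zero j
    subst this
    simp only [cell, boxes, Box.toSet, cellIndex, Set.mem_ofPred_eq, iff_true, and_true]
    exact fun i => ⟨(x i).2.1, (x i).2.2.lt_or_eq⟩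
  | succ p ih =>
    have hb := Z.boxes_lo_lt_hi p (Z.leaf p) (Z.dim p)
    have hl := Box.mem_lower hb.1 hb.2 (Z.ratio p).2 x
    have hu := Box.mem_upper hb.1 (Z.ratio p).2 x
    have hm : x ∈ (Z.boxes p (Z.leaf p)).toSet ↔ Z.cellIndex p x = Z.leaf p := ih (Z.leaf p)
    intro j
    refine Fin.lastCases ?_ (fun j => ?_) j
    · simp only [cell, boxes, Fin.snoc_last, cellIndex]
      rw [hl, hm]
      split_ifs with h1 h2
      · simp [h1, h2]
      · simp [h2, (Fin.castSucc_lt_last _).ne]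
      · simp [h1, (Fin.castSucc_lt_last _).ne]
    · simp only [cell, boxes, Fin.snoc_castSucc, cellIndex]
      by_cases hj : j = Z.leaf p
      · subst hj
        simp only [Function.update_self]
        rw [hu, hm]
        split_ifs with h1 h2
        · simp [h2, (Fin.castSucc_lt_last _).ne']
        · simp [h1, h2]
        · simp [h1]
      · rw [Function.update_of_ne hj]
        have := ih j
        unfold cell at this
        rw [this]
        split_ifs with h1 h2
        · simp [h1, (Fin.castSucc_lt_last _).ne', Ne.symm hj]
        · simp [h1]
        · simp

theorem mem_trees_iff (p : ℕ) (g : Cube d → ℤˣ) :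
    g ∈ Z.trees p ↔ ∃ c : Fin (p + 1) → ℤˣ, g = fun x => c (Z.cellIndex p x) := by
  unfold trees
  simp only [Set.mem_ofPred_eq]
  refine exists_congr fun c => ?_
  rw [funext_iff]
  refine forall_congr' fun x => ?_
  classical
  have : ∑ j, (Z.cell p j).indicator (fun _ => (c j : ℤ)) x = c (Z.cellIndex p x) := by
    rw [Finset.sum_eq_single (Z.cellIndex p x)]
    · rw [Set.indicator_of_mem ((Z.mem_cell_iff p x _).2 rfl)]
    · intro j _ hj
      rw [Set.indicator_of_notMem fun h => hj ((Z.mem_cell_iff p x _).1 h).symm]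
    · simp
  rw [this, Units.val_inj]

theorem trees_finite (p : ℕ) : (Z.trees p).Finite := by
  have : Z.trees p = Set.range fun c : Fin (p + 1) → ℤˣ => fun x => c (Z.cellIndex p x) := by
    ext g
    rw [mem_trees_iff, Set.mem_range]
    exact exists_congr fun c => eq_comm
  rw [this]
  exact Set.finite_range _

/-- A policy splits leaves, at the bottom, while `IsGuillotine` grows at the root. Hanging arbitrary
trees `φ j` on the cells reconciles the two: the last split is absorbed into the tree hung on the
cell it divides, leaving a statement about one split fewer. -/
theorem isGuillotine_comp_cellIndex (p : ℕ) : ∀ (q : Fin (p + 1) → ℕ)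
    (φ : Fin (p + 1) → Cube d → ℤˣ), (∀ j, IsGuillotine (q j) (φ j)) →
      IsGuillotine (p + ∑ j, q j) (fun x => φ (Z.cellIndex p x) x) := by
  induction p with
  | zero =>
    intro q φ h
    simpa [cellIndex] using h 0
  | succ p ih =>
    intro q φ h
    have key := ih (fun j => q j.castSucc + if j = Z.leaf p then q (Fin.last _) + 1 else 0)
      (fun j => if j = Z.leaf p then
        (fun x => if (x (Z.dim p) : ℝ) < (Z.boxes p (Z.leaf p)).cut (Z.dim p) (Z.ratio p)
          then φ (Fin.last _) x else φ j.castSucc x) else φ j.castSucc) (by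
        intro j
        by_cases hj : j = Z.leaf p
        · simp only [hj, if_true]
          have := IsGuillotine.node (Z.dim p)
            ((Z.boxes p (Z.leaf p)).cut (Z.dim p) (Z.ratio p)) (h (Fin.last _))
            (h (Z.leaf p).castSucc)
          convert this using 1
          omega
        · simpa only [hj, if_false, add_zero] using h j.castSucc)
    convert key using 1
    · rw [Finset.sum_add_distrib, Finset.sum_ite_eq', Fin.sum_univ_castSucc]
      simp only [Finset.mem_univ, if_true]
      omega
    · funext x
      simp only [cellIndex]
      by_cases h1 : Z.cellIndex p x = Z.leaf p
      · simp only [h1, if_true]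
        split_ifs <;> rfl
      · simp only [h1, if_false]

theorem isGuillotine_of_mem_trees {p : ℕ} {g : Cube d → ℤˣ} (hg : g ∈ Z.trees p) :
    IsGuillotine p g := by
  obtain ⟨c, rfl⟩ := (Z.mem_trees_iff p g).1 hg
  simpa using Z.isGuillotine_comp_cellIndex p (fun _ => 0) (fun j _ => c j)
    (fun j => IsGuillotine.leaf (c j))

end SplittingPolicy

/-! ### The growth function of guillotine trees -/

/-- Coefficient comparison in `(1-X)^(-(q+1)) (1-X)^(-(s+1)) = (1-X)^(-(q+s+2))`. It sums over the
ways a root split can divide the sample and lets the form of `growth` reproduce itself. -/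
theorem sum_antidiagonal_choose_mul_choose (q s n : ℕ) :
    ∑ ab ∈ Finset.HasAntidiagonal.antidiagonal n, (ab.1 + q).choose q * (ab.2 + s).choose s =
      (n + (q + s + 1)).choose (q + s + 1) := by
  have h := congrArg (PowerSeries.coeff (R := ℤ) n)
    (congrArg Units.val (PowerSeries.invOneSubPow_add ℤ (q + 1) (s + 1)))
  rw [show q + 1 + (s + 1) = (q + s + 1) + 1 by ring, Units.val_mul, PowerSeries.coeff_mul] at h
  simp only [PowerSeries.invOneSubPow_val_succ_eq_mk_add_choose, PowerSeries.coeff_mk] at h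
  rw [add_comm n]
  refine Eq.trans (Finset.sum_congr rfl fun ab _ => ?_) (by exact_mod_cast h.symm)
  rw [add_comm ab.1, add_comm ab.2]

open Classical in
/-- The subsets of `S` cut out by guillotine trees with `p` inner nodes. -/
def traces {d : ℕ} (S : Finset (Cube d)) (p : ℕ) : Finset (Finset (Cube d)) :=
  S.powerset.filter fun U => ∃ g, IsGuillotine p g ∧ U = S.filter (g · = 1)

theorem mem_traces {d p : ℕ} {S U : Finset (Cube d)} :
    U ∈ traces S p ↔ ∃ g, IsGuillotine p g ∧ U = S.filter (g · = 1) := by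
  classical
  unfold traces
  rw [Finset.mem_filter, and_iff_right_iff_imp]
  rintro ⟨g, _, rfl⟩
  exact Finset.mem_powerset.2 (Finset.filter_subset _ _)

/-- The bound on the number of traces. -/
def growth (d n p : ℕ) : ℕ := 2 * (2 * d) ^ p * catalan p * (n + p).choose p

theorem card_traces_le {d : ℕ} (p : ℕ) :
    ∀ S : Finset (Cube d), (traces S p).card ≤ growth d S.card p := by
  classical
  induction p using Nat.strong_induction_on with
  | _ p ih =>
  intro S
  rcases p with _ | p
  · have : traces S 0 ⊆ {∅, S} := by
      intro U hU
      obtain ⟨g, hg, rfl⟩ := mem_traces.1 hU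
      generalize hp : (0 : ℕ) = p' at hg
      cases hg with
      | leaf c =>
        by_cases hc : c = 1 <;> simp [hc]
      | node => omega
    refine (Finset.card_le_card this).trans ((Finset.card_le_two).trans ?_)
    simp [growth]
  -- `F i ab qs` collects the traces whose root compares coordinate `i`, sends `ab` sample points to
  -- the two sides, and has `qs` inner nodes in its two subtrees.
  · set F : Fin d → ℕ × ℕ → ℕ × ℕ → Finset (Finset (Cube d)) := fun i ab qs =>
      S.powerset.filter fun W => ∃ (s : ℝ) (U V : Finset (Cube d)),
        (S.filter fun x => (x i : ℝ) < s).card = ab.1 ∧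
        (S.filter fun x => ¬ (x i : ℝ) < s).card = ab.2 ∧
        U ∈ traces (S.filter fun x => (x i : ℝ) < s) qs.1 ∧
        V ∈ traces (S.filter fun x => ¬ (x i : ℝ) < s) qs.2 ∧ W = U ∪ V with hF
    have hcov : traces S (p + 1) ⊆ Finset.univ.biUnion fun i =>
        (Finset.HasAntidiagonal.antidiagonal S.card).biUnion fun ab =>
          (Finset.HasAntidiagonal.antidiagonal p).biUnion fun qs => F i ab qs := by
      intro W hW
      obtain ⟨g, hg, rfl⟩ := mem_traces.1 hW
      generalize hp : p + 1 = p' at hg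
      cases hg with
      | leaf c => omega
      | @node i s q q' g h h1 h2 =>
        simp only [Finset.mem_biUnion, Finset.mem_univ, true_and]
        refine ⟨i, ((S.filter fun x => (x i : ℝ) < s).card,
          (S.filter fun x => ¬ (x i : ℝ) < s).card), ?_, (q, q'), ?_, ?_⟩
        · rw [Finset.HasAntidiagonal.mem_antidiagonal]
          exact Finset.card_filter_add_card_filter_not _
        · rw [Finset.HasAntidiagonal.mem_antidiagonal]; simp only; omega
        · rw [hF, Finset.mem_filter, Finset.mem_powerset]
          refine ⟨Finset.filter_subset _ _, s, _, _, rfl, rfl, mem_traces.2 ⟨g, h1, rfl⟩,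
            mem_traces.2 ⟨h, h2, rfl⟩, ?_⟩
          ext x
          simp only [Finset.mem_filter, Finset.mem_union]
          split_ifs with hx <;> simp [hx]
    have hFcard : ∀ i, ∀ ab ∈ Finset.HasAntidiagonal.antidiagonal S.card, ∀ qs ∈ Finset.HasAntidiagonal.antidiagonal p,
        (F i ab qs).card ≤ growth d ab.1 qs.1 * growth d ab.2 qs.2 := by
      intro i ab hab qs hqs
      rw [Finset.HasAntidiagonal.mem_antidiagonal] at hqs
      by_cases hs : ∃ s : ℝ, (S.filter fun x => (x i : ℝ) < s).card = ab.1 ∧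
        (S.filter fun x => ¬ (x i : ℝ) < s).card = ab.2
      · obtain ⟨s, hs1, hs2⟩ := hs
        have hsub : F i ab qs ⊆ Finset.image₂ (· ∪ ·)
            (traces (S.filter fun x => (x i : ℝ) < s) qs.1)
            (traces (S.filter fun x => ¬ (x i : ℝ) < s) qs.2) := by
          intro W hW
          rw [hF, Finset.mem_filter] at hW
          obtain ⟨_, s', U, V, h1, h2, hU, hV, rfl⟩ := hW
          have hmono : ∀ a b : ℝ, a ≤ b → (S.filter fun x => (x i : ℝ) < a) ⊆
              (S.filter fun x => (x i : ℝ) < b) := fun a b hab =>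
            Finset.monotone_filter_right _ fun x _ hx => lt_of_lt_of_le hx hab
          -- The sets `{x i < s}` are nested in `s`, so their cardinality determines them: all
          -- thresholds counted by `F i ab qs` induce the same split of `S`.
          have e1 : (S.filter fun x => (x i : ℝ) < s') = S.filter fun x => (x i : ℝ) < s := by
            rcases le_total s' s with hle | hle
            · exact Finset.eq_of_subset_of_card_le (hmono _ _ hle) (by rw [h1, hs1])
            · exact (Finset.eq_of_subset_of_card_le (hmono _ _ hle) (by rw [h1, hs1])).symm
          have e2 : (S.filter fun x => ¬ (x i : ℝ) < s') =
              S.filter fun x => ¬ (x i : ℝ) < s := by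
            rw [Finset.filter_not, Finset.filter_not, e1]
          rw [e1] at hU
          rw [e2] at hV
          exact Finset.mem_image₂_of_mem hU hV
        refine (Finset.card_le_card hsub).trans ((Finset.card_image₂_le _ _ _).trans ?_)
        have t1 := ih qs.1 (by omega) (S.filter fun x => (x i : ℝ) < s)
        have t2 := ih qs.2 (by omega) (S.filter fun x => ¬ (x i : ℝ) < s)
        rw [hs1] at t1
        rw [hs2] at t2
        exact Nat.mul_le_mul t1 t2
      · have : F i ab qs = ∅ := by
          rw [hF, Finset.filter_eq_empty_iff]
          rintro W - ⟨s, U, V, h1, h2, -⟩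
          exact hs ⟨s, h1, h2⟩
        simp [this]
    calc (traces S (p + 1)).card
        ≤ ∑ i : Fin d, ∑ ab ∈ Finset.HasAntidiagonal.antidiagonal S.card, ∑ qs ∈ Finset.HasAntidiagonal.antidiagonal p,
            growth d ab.1 qs.1 * growth d ab.2 qs.2 := by
          refine (Finset.card_le_card hcov).trans (Finset.card_biUnion_le.trans ?_)
          refine Finset.sum_le_sum fun i _ => Finset.card_biUnion_le.trans ?_
          refine Finset.sum_le_sum fun ab hab => Finset.card_biUnion_le.trans ?_
          exact Finset.sum_le_sum fun qs hqs => hFcard i ab hab qs hqs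
      _ = growth d S.card (p + 1) := by
          rw [Finset.sum_const, Finset.card_univ, Fintype.card_fin, Finset.sum_comm]
          have : ∀ qs ∈ Finset.HasAntidiagonal.antidiagonal p, ∑ ab ∈ Finset.HasAntidiagonal.antidiagonal S.card,
              growth d ab.1 qs.1 * growth d ab.2 qs.2 =
              4 * (2 * d) ^ p * (S.card + (p + 1)).choose (p + 1) *
                (catalan qs.1 * catalan qs.2) := by
            intro qs hqs
            rw [Finset.HasAntidiagonal.mem_antidiagonal] at hqs
            rw [← hqs, ← sum_antidiagonal_choose_mul_choose, Finset.mul_sum, Finset.sum_mul]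
            refine Finset.sum_congr rfl fun ab _ => ?_
            unfold growth
            ring
          -- The convolution over the node counts of the subtrees is the Catalan recursion.
          rw [Finset.sum_congr rfl this, ← Finset.mul_sum, ← catalan_succ', growth, smul_eq_mul]
          ring

theorem growth_mono {d n m p : ℕ} (h : n ≤ m) : growth d n p ≤ growth d m p := by
  unfold growth
  exact Nat.mul_le_mul_left _ (Nat.choose_le_choose _ (by omega))

theorem catalan_le_four_pow (p : ℕ) : catalan p ≤ 4 ^ p := by
  rw [catalan_eq_centralBinom_div]
  exact (Nat.div_le_self _ _).trans
    ((Nat.choose_le_two_pow _ _).trans (by rw [pow_mul]; norm_num))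

/-! ### Packing numbers of guillotine trees -/

/-- Vectors that differ pairwise in many coordinates are separated by few of the coordinates. -/
theorem exists_separating {n m : ℕ} (hn : 0 < n) {ι β : Type*} [DecidableEq β] (N : Finset ι)
    (v : ι → Fin n → β) {κ : ℝ}
    (hv : ∀ f ∈ N, ∀ g ∈ N, f ≠ g →
      ((Finset.univ.filter fun i => v f i = v g i).card : ℝ) ≤ (1 - κ) * n)
    (hm : (N.card : ℝ) ^ 2 * (1 - κ) ^ m < 1) :
    ∃ I : Fin m → Fin n, ∀ f ∈ N, ∀ g ∈ N, (∀ k, v f (I k) = v g (I k)) → f = g := by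
  classical
  -- Counting form of the probabilistic method: if no `m`-tuple of indices separated, the `n^m`
  -- tuples would be covered by the bad sets of the pairs, each of size at most `((1-κ)n)^m`.
  by_contra! hcon
  have hsub : (Finset.univ : Finset (Fin m → Fin n)) ⊆ N.offDiag.biUnion fun fg =>
      Fintype.piFinset fun _ => Finset.univ.filter fun i => v fg.1 i = v fg.2 i := by
    intro I _
    obtain ⟨f, hf, g, hg, h1, h2⟩ := hcon I
    simp only [Finset.mem_biUnion, Finset.mem_offDiag, Fintype.mem_piFinset, Finset.mem_filter,
      Finset.mem_univ, true_and]
    exact ⟨(f, g), ⟨hf, hg, h2⟩, h1⟩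
  have hcard := (Finset.card_le_card hsub).trans Finset.card_biUnion_le
  simp only [Finset.card_univ, Fintype.card_pi, Fintype.card_fin, Finset.prod_const,
    Fintype.card_piFinset] at hcard
  have hn' : (0 : ℝ) < (n : ℝ) ^ m := by positivity
  have h1 : ((n : ℝ) ^ m) ≤ ∑ fg ∈ N.offDiag,
      ((Finset.univ.filter fun i => v fg.1 i = v fg.2 i).card : ℝ) ^ m := by
    exact_mod_cast hcard
  have h2 : ∑ fg ∈ N.offDiag,
      ((Finset.univ.filter fun i => v fg.1 i = v fg.2 i).card : ℝ) ^ m ≤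
      N.offDiag.card * ((1 - κ) * n) ^ m := by
    rw [← nsmul_eq_mul]
    refine Finset.sum_le_card_nsmul _ _ _ fun fg hfg => ?_
    rw [Finset.mem_offDiag] at hfg
    exact pow_le_pow_left₀ (by positivity) (hv _ hfg.1 _ hfg.2.1 hfg.2.2) m
  rcases N.offDiag.eq_empty_or_nonempty with he | ⟨fg, hfg⟩
  · rw [he] at h1
    simp only [Finset.sum_empty] at h1
    linarith
  · rw [Finset.mem_offDiag] at hfg
    -- `κ ≤ 1` is not assumed; a pair of distinct elements supplies it through `hv`.
    have hκ : 0 ≤ (1 - κ) := by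
      have := (Nat.cast_nonneg _).trans (hv _ hfg.1 _ hfg.2.1 hfg.2.2)
      exact nonneg_of_mul_nonneg_left this (by exact_mod_cast hn)
    have h3 : (N.offDiag.card : ℝ) ≤ (N.card : ℝ) ^ 2 := by
      rw [Finset.offDiag_card, sq]
      exact_mod_cast Nat.sub_le _ _
    have h4 : (N.offDiag.card : ℝ) * ((1 - κ) * n) ^ m ≤
        (N.card : ℝ) ^ 2 * (1 - κ) ^ m * (n : ℝ) ^ m := by
      rw [mul_pow, mul_assoc]
      exact mul_le_mul_of_nonneg_right h3 (by positivity)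
    nlinarith

/-- Once a tuple of `m` sample points tells the trees of `N` apart, their traces on these points are
distinct, so the count of traces applies with `m` in place of the sample size `n`. -/
theorem card_le_growth_of_separated {d n m p : ℕ} (hn : 0 < n) (D : Fin n → Cube d)
    (N : Finset (Cube d → ℤˣ)) (hN : ∀ g ∈ N, IsGuillotine p g) {κ : ℝ}
    (hv : ∀ f ∈ N, ∀ g ∈ N, f ≠ g →
      ((Finset.univ.filter fun i => f (D i) = g (D i)).card : ℝ) ≤ (1 - κ) * n)
    (hm : (N.card : ℝ) ^ 2 * (1 - κ) ^ m < 1) : N.card ≤ growth d m p := by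
  classical
  obtain ⟨I, hI⟩ := exists_separating hn N (fun g i => g (D i)) hv hm
  set S : Finset (Cube d) := Finset.univ.image fun k => D (I k) with hS
  have hScard : S.card ≤ m := by
    simpa using Finset.card_image_le (s := Finset.univ) (f := fun k => D (I k))
  refine le_trans ?_ ((card_traces_le p S).trans (growth_mono hScard))
  refine Finset.card_le_card_of_injOn (fun g => S.filter (g · = 1))
    (fun g hg => mem_traces.2 ⟨g, hN g hg, rfl⟩) ?_
  intro f hf g hg hfg
  refine hI f hf g hg fun k => ?_
  have hk : D (I k) ∈ S := Finset.mem_image_of_mem _ (Finset.mem_univ k)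
  have h1 : f (D (I k)) = 1 ↔ g (D (I k)) = 1 := by
    have := congrArg (D (I k) ∈ ·) hfg
    simpa [hk] using this
  rcases Int.units_eq_one_or (f (D (I k))) with hf1 | hf1
  · exact hf1.trans (h1.1 hf1).symm
  · rcases Int.units_eq_one_or (g (D (I k))) with hg1 | hg1
    · exact absurd (h1.2 hg1) (by rw [hf1]; decide)
    · exact hf1.trans hg1.symm

/-- The binomial coefficient is controlled by one term of the expansion of `(1+t)^(m+p) ≤ exp
(t(m+p))`. The free `t` makes the cost linear in `m` with a slope that can be chosen small. -/
theorem log_growth_le {d m p : ℕ} (hd : 0 < d) {t : ℝ} (ht : 0 < t) :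
    Real.log (growth d m p) ≤
      Real.log 2 + p * Real.log (8 * d / t) + t * (m + p) := by
  have hd' : (0 : ℝ) < d := by exact_mod_cast hd
  have h1 : ((m + p).choose p : ℝ) * t ^ p ≤ Real.exp (t * (m + p)) := by
    calc ((m + p).choose p : ℝ) * t ^ p = t ^ p * 1 ^ (m + p - p) * (m + p).choose p := by ring
      _ ≤ ∑ k ∈ Finset.range (m + p + 1), t ^ k * 1 ^ (m + p - k) * (m + p).choose k :=
          Finset.single_le_sum (f := fun k => t ^ k * 1 ^ (m + p - k) * ((m + p).choose k : ℝ))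
            (fun k _ => by positivity) (Finset.mem_range.2 (by omega))
      _ = (t + 1) ^ (m + p) := (add_pow t 1 (m + p)).symm
      _ ≤ Real.exp t ^ (m + p) := pow_le_pow_left₀ (by positivity) (Real.add_one_le_exp t) _
      _ = Real.exp (t * (m + p)) := by
          rw [← Real.exp_nat_mul]
          congr 1
          push_cast
          ring
  have h2 : (growth d m p : ℝ) ≤ 2 * (8 * d / t) ^ p * Real.exp (t * (m + p)) := by
    have h3 : (catalan p : ℝ) ≤ 4 ^ p := by exact_mod_cast catalan_le_four_pow p
    calc (growth d m p : ℝ) = 2 * (2 * d) ^ p * catalan p * (m + p).choose p := by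
          simp [growth]
      _ ≤ 2 * (2 * d) ^ p * 4 ^ p * (m + p).choose p := by gcongr
      _ = 2 * (8 * d / t) ^ p * ((m + p).choose p * t ^ p) := by
          rw [div_pow, show (8 : ℝ) * d = (2 * d) * 4 by ring, mul_pow _ (4 : ℝ)]
          field_simp
      _ ≤ _ := by gcongr
  by_cases h0 : growth d m p = 0
  · exfalso
    have hc : 0 < catalan p := by
      rw [Nat.pos_iff_ne_zero]
      intro h
      have := succ_mul_catalan_eq_centralBinom p
      rw [h] at this
      exact (Nat.centralBinom_ne_zero p) (by simpa using this.symm)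
    have : 0 < growth d m p := by
      unfold growth
      have := Nat.choose_pos (n := m + p) (k := p) (by omega)
      positivity
    omega
  · have h0' : (0 : ℝ) < growth d m p := by exact_mod_cast Nat.pos_of_ne_zero h0
    calc Real.log (growth d m p) ≤ Real.log (2 * (8 * d / t) ^ p * Real.exp (t * (m + p))) :=
          Real.log_le_log h0' h2
      _ = _ := by
          rw [Real.log_mul (by positivity) (by positivity), Real.log_mul (by positivity)
            (by positivity), Real.log_pow, Real.log_exp]

/-- The sample size needed for separation is itself proportional to `log N.card`, so the trace count
bounds this logarithm in terms of itself. The slope `t = κ/8` makes that contribution a quarter of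
the left side; moving it over produces the factor `4/3`. -/
theorem log_card_le_of_separated {d n p : ℕ} (hd : 0 < d) (hn : 0 < n) (D : Fin n → Cube d)
    (N : Finset (Cube d → ℤˣ)) (hN : ∀ g ∈ N, IsGuillotine p g) {κ : ℝ} (hκ : 0 < κ)
    (hκ1 : κ ≤ 1)
    (hv : ∀ f ∈ N, ∀ g ∈ N, f ≠ g →
      ((Finset.univ.filter fun i => f (D i) = g (D i)).card : ℝ) ≤ (1 - κ) * n) :
    Real.log N.card ≤ 4 / 3 * (1 + p * (1 / 8 + Real.log (64 * d / κ))) := by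
  have hd' : (1 : ℝ) ≤ d := by exact_mod_cast hd
  have hlog : 0 ≤ Real.log (64 * d / κ) := by
    refine Real.log_nonneg ?_
    rw [le_div_iff₀ hκ]
    nlinarith
  rcases N.eq_empty_or_nonempty with he | hne
  · simp only [he, Finset.card_empty, Nat.cast_zero, Real.log_zero]
    positivity
  have hM : (1 : ℝ) ≤ N.card := by exact_mod_cast hne.card_pos
  set M : ℝ := (N.card : ℝ) with hMdef
  have hlM : 0 ≤ Real.log M := Real.log_nonneg hM
  -- The `+ 1` makes `κ m > 2 log M` strict, hence `M² (1-κ)^m ≤ exp (2 log M - κ m) < 1`.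
  set m : ℕ := ⌊2 * Real.log M / κ⌋₊ + 1 with hmdef
  have hm1 : 2 * Real.log M / κ < m := by
    rw [hmdef]; push_cast; exact Nat.lt_floor_add_one _
  have hm2 : (m : ℝ) ≤ 2 * Real.log M / κ + 1 := by
    rw [hmdef]; push_cast
    have := Nat.floor_le (a := 2 * Real.log M / κ) (by positivity)
    linarith
  have hm : M ^ 2 * (1 - κ) ^ m < 1 := by
    have h1 : (1 - κ) ^ m ≤ Real.exp (-(κ * m)) := by
      calc (1 - κ) ^ m ≤ Real.exp (-κ) ^ m :=
            pow_le_pow_left₀ (by linarith) (Real.one_sub_le_exp_neg κ) _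
        _ = _ := by rw [← Real.exp_nat_mul]; congr 1; ring
    have h2 : M ^ 2 = Real.exp (2 * Real.log M) := by
      rw [two_mul, Real.exp_add, Real.exp_log (by linarith), sq]
    calc M ^ 2 * (1 - κ) ^ m ≤ Real.exp (2 * Real.log M) * Real.exp (-(κ * m)) := by
          rw [h2]; gcongr
      _ = Real.exp (2 * Real.log M - κ * m) := by rw [← Real.exp_add]; ring_nf
      _ < 1 := by
          rw [Real.exp_lt_one_iff]
          rw [div_lt_iff₀ hκ] at hm1
          linarith
  have hle := card_le_growth_of_separated hn D N hN hv hm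
  have h3 : Real.log M ≤ Real.log (growth d m p) :=
    Real.log_le_log (by linarith) (Nat.cast_le.2 hle)
  have h4 := h3.trans (log_growth_le hd (t := κ / 8) (by positivity))
  have h5 : 8 * (d : ℝ) / (κ / 8) = 64 * d / κ := by field_simp; norm_num
  rw [h5] at h4
  have h6 : κ / 8 * (m + p) ≤ Real.log M / 4 + 1 / 8 + p / 8 := by
    have h7 : κ * m ≤ 2 * Real.log M + κ := by
      calc κ * m ≤ κ * (2 * Real.log M / κ + 1) := by gcongr
        _ = _ := by field_simp
    have h8 : κ * p ≤ p := by
      have : (0 : ℝ) ≤ p := by positivity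
      nlinarith
    linarith
  have h9 : Real.log 2 < 0.7 := by linarith [Real.log_two_lt_d9]
  linarith

/-- The metric entropy of guillotine trees with `p ≤ ρ` inner nodes, in polynomial form. -/
theorem log_two_mul_card_le_of_separated {d n p : ℕ} (hd : 0 < d) (hn : 0 < n)
    (D : Fin n → Cube d) (N : Finset (Cube d → ℤˣ)) (hN : ∀ g ∈ N, IsGuillotine p g)
    {κ : ℝ} (hκ : 0 < κ) (hκ1 : κ ≤ 1)
    (hv : ∀ f ∈ N, ∀ g ∈ N, f ≠ g →
      ((Finset.univ.filter fun i => f (D i) = g (D i)).card : ℝ) ≤ (1 - κ) * n)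
    {δ A : ℝ} (hδ : 0 < δ) (hδ1 : δ < 1) (hA : 1 ≤ A)
    (hpA : 18 * d / (Real.exp 1 * δ) * p ≤ A) :
    Real.log (2 * N.card) ≤ 4 * A * κ ^ (-δ) := by
  have hd' : (1 : ℝ) ≤ d := by exact_mod_cast hd
  have hd0 : (0 : ℝ) < d := by linarith
  have hκδ : 1 ≤ κ ^ (-δ) := Real.one_le_rpow_of_pos_of_le_one_of_nonpos hκ hκ1 (by linarith)
  have hl2 : Real.log 2 < 0.7 := by linarith [Real.log_two_lt_d9]
  rcases N.eq_empty_or_nonempty with he | hne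
  · simp only [he, Finset.card_empty, Nat.cast_zero, mul_zero, Real.log_zero]
    positivity
  have hM : (0 : ℝ) < N.card := by exact_mod_cast hne.card_pos
  have h1 := log_card_le_of_separated hd hn D N hN hκ hκ1 hv
  have h2 : Real.log (64 * d / κ) ≤ 4.2 + d + κ ^ (-δ) / δ := by
    rw [Real.log_div (by positivity) hκ.ne', Real.log_mul (by norm_num) (by positivity),
      show (64 : ℝ) = 2 ^ 6 by norm_num, Real.log_pow]
    have h3 := Real.log_le_sub_one_of_pos hd0
    -- This is `log x ≤ x - 1` at `x = κ^(-δ)`; here the logarithmic entropy becomes polynomial.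
    have h4 : -Real.log κ ≤ κ ^ (-δ) / δ := by
      rw [le_div_iff₀ hδ]
      have h5 := Real.log_le_sub_one_of_pos (Real.rpow_pos_of_pos hκ (-δ))
      rw [Real.log_rpow hκ] at h5
      linarith
    push_cast
    linarith
  have hx : 1 ≤ (d : ℝ) / δ := by rw [le_div_iff₀ hδ]; linarith
  -- The three contributions are at most `4.325`, `1` and `1` times `(d/δ) κ^(-δ)`. Since `6.4 <
  -- 18/e`, the constant in `hpA` suffices.
  have h6 : 1 / 8 + Real.log (64 * d / κ) ≤ 6.4 * (d / δ) * κ ^ (-δ) := by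
    have e1 : κ ^ (-δ) / δ ≤ d / δ * κ ^ (-δ) := by
      rw [div_mul_eq_mul_div, mul_comm]
      gcongr
      nlinarith
    have e2 : (d : ℝ) ≤ d / δ := by
      rw [le_div_iff₀ hδ]; nlinarith
    have e3 : d / δ ≤ d / δ * κ ^ (-δ) := by
      nlinarith
    linarith
  have h7 : 6.4 * (d / δ) * p ≤ A := by
    refine le_trans ?_ hpA
    gcongr
    rw [show 18 * (d : ℝ) / (Real.exp 1 * δ) = 18 / Real.exp 1 * (d / δ) by
      field_simp]
    gcongr
    rw [le_div_iff₀ (Real.exp_pos 1)]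
    linarith [Real.exp_one_lt_d9]
  have h8 : p * (1 / 8 + Real.log (64 * d / κ)) ≤ A * κ ^ (-δ) := by
    calc p * (1 / 8 + Real.log (64 * d / κ)) ≤ p * (6.4 * (d / δ) * κ ^ (-δ)) := by gcongr
      _ = 6.4 * (d / δ) * p * κ ^ (-δ) := by ring
      _ ≤ _ := by gcongr
  rw [Real.log_mul (by norm_num) hM.ne']
  have h9 : 1 ≤ A * κ ^ (-δ) := by nlinarith
  linarith

/-! ### Rademacher averages of finite classes -/

section Signs

variable {n : ℕ}

/-- The mean of a function of `n` independent uniformly distributed signs. -/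
def signMean (φ : (Fin n → ℤˣ) → ℝ) : ℝ := (2 ^ n : ℝ)⁻¹ * ∑ ε, φ ε

theorem signMean_mono {φ ψ : (Fin n → ℤˣ) → ℝ} (h : ∀ ε, φ ε ≤ ψ ε) :
    signMean φ ≤ signMean ψ :=
  mul_le_mul_of_nonneg_left (Finset.sum_le_sum fun ε _ => h ε) (by positivity)

theorem signMean_add (φ ψ : (Fin n → ℤˣ) → ℝ) :
    signMean (fun ε => φ ε + ψ ε) = signMean φ + signMean ψ := by
  simp [signMean, Finset.sum_add_distrib, mul_add]

theorem signMean_const_mul (a : ℝ) (φ : (Fin n → ℤˣ) → ℝ) :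
    signMean (fun ε => a * φ ε) = a * signMean φ := by
  simp only [signMean, ← Finset.mul_sum]
  ring

theorem signMean_const (a : ℝ) : signMean (fun _ : Fin n → ℤˣ => a) = a := by
  simp [signMean, Finset.card_univ, Fintype.card_pi]

theorem signMean_sum {ι : Type*} (s : Finset ι) (φ : ι → (Fin n → ℤˣ) → ℝ) :
    signMean (fun ε => ∑ f ∈ s, φ f ε) = ∑ f ∈ s, signMean (φ f) := by
  simp only [signMean]
  rw [Finset.sum_comm, Finset.mul_sum]

theorem signMean_exp_sum (a : Fin n → ℝ) :
    signMean (fun ε => Real.exp (∑ i, ((ε i : ℤ) : ℝ) * a i)) = ∏ i, Real.cosh (a i) := by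
  have h : ∏ i, (2 * Real.cosh (a i)) =
      ∑ ε : Fin n → ℤˣ, Real.exp (∑ i, ((ε i : ℤ) : ℝ) * a i) := by
    have : ∀ i, 2 * Real.cosh (a i) = ∑ e : ℤˣ, Real.exp (((e : ℤ) : ℝ) * a i) := by
      intro i
      rw [UnitsInt.univ, Finset.sum_pair (by decide), Real.cosh_eq]
      simp
      ring
    simp_rw [this, Real.exp_sum]
    rw [Finset.prod_univ_sum, Fintype.piFinset_univ]
  rw [signMean, ← h, Finset.prod_mul_distrib, Finset.prod_const, Finset.card_univ,
    Fintype.card_fin, inv_mul_cancel_left₀ (by positivity)]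

/-- Signed sums are sub-Gaussian: independence factors the mean into hyperbolic cosines, and `cosh x
≤ exp (x²/2)`. -/
theorem signMean_exp_le (a : Fin n → ℝ) :
    signMean (fun ε => Real.exp (∑ i, ((ε i : ℤ) : ℝ) * a i)) ≤
      Real.exp ((∑ i, a i ^ 2) / 2) := by
  rw [signMean_exp_sum, Finset.sum_div, Real.exp_sum]
  exact Finset.prod_le_prod (fun i _ => (Real.cosh_pos _).le)
    fun i _ => Real.cosh_le_exp_half_sq _

end Signs

section Empirical

variable {S : Type*} {n : ℕ}

/-- The signed average `n⁻¹ ∑ ε_i f(D_i)`. -/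
def signedAvg (D : Fin n → S) (ε : Fin n → ℤˣ) (f : S → ℝ) : ℝ :=
  (n : ℝ)⁻¹ * ∑ i, ((ε i : ℤ) : ℝ) * f (D i)

/-- The empirical second moment `n⁻¹ ∑ f(D_i)²`. -/
def empSq (D : Fin n → S) (f : S → ℝ) : ℝ := (n : ℝ)⁻¹ * ∑ i, f (D i) ^ 2

theorem empSq_nonneg (D : Fin n → S) (f : S → ℝ) : 0 ≤ empSq D f := by
  unfold empSq
  have := Finset.sum_nonneg fun (i : Fin n) (_ : i ∈ Finset.univ) => sq_nonneg (f (D i))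
  positivity

theorem rademacher_eq (F : Set (S → ℝ)) (D : Fin n → S) :
    rademacher F D = signMean fun ε => ⨆ f : F, |signedAvg D ε f| := rfl

theorem signedAvg_add (D : Fin n → S) (ε : Fin n → ℤˣ) (f g : S → ℝ) :
    signedAvg D ε (f + g) = signedAvg D ε f + signedAvg D ε g := by
  simp [signedAvg, mul_add, Finset.sum_add_distrib]

theorem abs_signedAvg_le_sqrt (hn : 0 < n) (D : Fin n → S) (ε : Fin n → ℤˣ) (f : S → ℝ) :
    |signedAvg D ε f| ≤ Real.sqrt (empSq D f) := by
  have hn' : (0 : ℝ) < n := by exact_mod_cast hn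
  refine Real.abs_le_sqrt ?_
  have h := Finset.sum_mul_sq_le_sq_mul_sq Finset.univ (fun i => ((ε i : ℤ) : ℝ))
    fun i => f (D i)
  have h1 : ∑ i, ((ε i : ℤ) : ℝ) ^ 2 = n := by
    have : ∀ i, ((ε i : ℤ) : ℝ) ^ 2 = 1 := fun i => by
      rcases Int.units_eq_one_or (ε i) with h | h <;> simp [h]
    simp [this]
  rw [h1] at h
  unfold signedAvg empSq
  rw [mul_pow, sq (n : ℝ)⁻¹, mul_assoc]
  refine mul_le_mul_of_nonneg_left ?_ (by positivity)
  rw [inv_mul_le_iff₀ hn']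
  exact h

theorem le_iSup_abs_signedAvg {F : Set (S → ℝ)} (hF : F.Finite) (D : Fin n → S)
    (ε : Fin n → ℤˣ) {f : S → ℝ} (hf : f ∈ F) :
    |signedAvg D ε f| ≤ ⨆ f : F, |signedAvg D ε f| := by
  have := hF.to_subtype
  exact le_ciSup (f := fun f : F => |signedAvg D ε f|) (Set.finite_range _).bddAbove ⟨f, hf⟩

theorem rademacher_nonneg (F : Set (S → ℝ)) (D : Fin n → S) : 0 ≤ rademacher F D := by
  rw [rademacher_eq, ← signMean_const (n := n) 0]
  exact signMean_mono fun ε => Real.iSup_nonneg fun f => abs_nonneg _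

/-- Massart's lemma. -/
theorem rademacher_le_of_card (hn : 0 < n) (D : Fin n → S) (F : Finset (S → ℝ))
    {ρ K : ℝ} (hρ : 0 < ρ) (hK : 0 < K) (hF : ∀ f ∈ F, empSq D f ≤ ρ ^ 2)
    (hcard : Real.log (2 * F.card) ≤ K) :
    rademacher (F : Set (S → ℝ)) D ≤ ρ * Real.sqrt (2 * K / n) := by
  have hn' : (0 : ℝ) < n := by exact_mod_cast hn
  rcases F.eq_empty_or_nonempty with rfl | hne
  · have : rademacher ((∅ : Finset (S → ℝ)) : Set (S → ℝ)) D = 0 := by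
      rw [rademacher_eq]
      simp [signMean]
    rw [this]
    positivity
  have hc : (0 : ℝ) < F.card := by exact_mod_cast hne.card_pos
  set q : ℝ := Real.sqrt (2 * K / n) with hq
  have hq0 : 0 < q := Real.sqrt_pos.2 (by positivity)
  have hq2 : q ^ 2 = 2 * K / n := Real.sq_sqrt (by positivity)
  -- This choice makes the sub-Gaussian exponent `s²ρ²/(2n)` equal to `K`, matching the logarithm of
  -- the number of signed functions.
  set s : ℝ := n * q / ρ with hs
  have hs0 : 0 < s := by positivity
  have hexp : ∀ f ∈ F, ∀ u : ℝ, u ^ 2 = 1 →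
      signMean (fun ε => Real.exp (s * (u * signedAvg D ε f))) ≤ Real.exp K := by
    intro f hf u hu
    have e : ∀ ε : Fin n → ℤˣ, s * (u * signedAvg D ε f) =
        ∑ i, ((ε i : ℤ) : ℝ) * (s * u / n * f (D i)) := by
      intro ε
      unfold signedAvg
      simp only [Finset.mul_sum]
      refine Finset.sum_congr rfl fun i _ => ?_
      field_simp
    simp only [e]
    refine (signMean_exp_le _).trans (Real.exp_le_exp.2 ?_)
    have h1 : ∑ i, (s * u / n * f (D i)) ^ 2 = s ^ 2 / n * empSq D f := by
      unfold empSq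
      simp only [Finset.mul_sum]
      refine Finset.sum_congr rfl fun i _ => ?_
      rw [mul_pow, div_pow, mul_pow, hu]
      field_simp
    rw [h1]
    calc s ^ 2 / n * empSq D f / 2 ≤ s ^ 2 / n * ρ ^ 2 / 2 := by gcongr; exact hF f hf
      _ = n * q ^ 2 / 2 := by rw [hs]; field_simp
      _ = K := by rw [hq2]; field_simp
  have hsup : ∀ ε : Fin n → ℤˣ,
      Real.exp (s * ⨆ f : (F : Set (S → ℝ)), |signedAvg D ε f|) ≤
        ∑ f ∈ F, (Real.exp (s * (1 * signedAvg D ε f)) +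
          Real.exp (s * (-1 * signedAvg D ε f))) := by
    intro ε
    have : Nonempty (F : Set (S → ℝ)) := hne.coe_sort
    obtain ⟨f, hf⟩ := exists_eq_ciSup_of_finite
      (f := fun f : (F : Set (S → ℝ)) => |signedAvg D ε f|)
    rw [← hf]
    refine le_trans ?_ (Finset.single_le_sum (f := fun f =>
      Real.exp (s * (1 * signedAvg D ε f)) + Real.exp (s * (-1 * signedAvg D ε f)))
      (fun f _ => by positivity) f.2)
    rcases abs_cases (signedAvg D ε f) with h | h
    · rw [h.1, one_mul]
      exact le_add_of_nonneg_right (Real.exp_pos _).le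
    · rw [h.1, neg_one_mul]
      exact le_add_of_nonneg_left (Real.exp_pos _).le
  have hmean : signMean (fun ε => Real.exp (s * ⨆ f : (F : Set (S → ℝ)), |signedAvg D ε f|)) ≤
      Real.exp (2 * K) := by
    refine (signMean_mono hsup).trans ?_
    rw [signMean_sum]
    calc _ ≤ ∑ f ∈ F, (Real.exp K + Real.exp K) := by
          refine Finset.sum_le_sum fun f hf => ?_
          rw [signMean_add]
          exact add_le_add (hexp f hf 1 (by norm_num)) (hexp f hf (-1) (by norm_num))
      _ = 2 * F.card * Real.exp K := by rw [Finset.sum_const, nsmul_eq_mul]; ring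
      _ ≤ Real.exp K * Real.exp K := by
          gcongr
          rw [← Real.log_le_iff_le_exp (by positivity)]
          exact hcard
      _ = _ := by rw [← Real.exp_add]; ring_nf
  -- The tangent `x - 2K + 1 ≤ exp (x - 2K)`, averaged over the signs, takes the place of Jensen's
  -- inequality for `exp`.
  have hlin : s * rademacher (F : Set (S → ℝ)) D - 2 * K + 1 ≤ 1 := by
    have h1 : signMean (fun ε => s * (⨆ f : (F : Set (S → ℝ)), |signedAvg D ε f|) +
        (-(2 * K) + 1)) ≤ signMean (fun ε => Real.exp (-(2 * K)) *
          Real.exp (s * ⨆ f : (F : Set (S → ℝ)), |signedAvg D ε f|)) := by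
      refine signMean_mono fun ε => ?_
      rw [← Real.exp_add]
      refine le_trans (le_of_eq ?_) (Real.add_one_le_exp _)
      ring
    rw [signMean_add, signMean_const, signMean_const_mul, signMean_const_mul] at h1
    have h2 : Real.exp (-(2 * K)) * Real.exp (2 * K) = 1 := by
      rw [← Real.exp_add]; simp
    have h3 := mul_le_mul_of_nonneg_left hmean (Real.exp_pos (-(2 * K))).le
    rw [rademacher_eq]
    linarith
  have h4 : rademacher (F : Set (S → ℝ)) D ≤ 2 * K / s := by
    rw [le_div_iff₀ hs0]
    linarith
  refine h4.trans (le_of_eq ?_)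
  rw [div_eq_iff hs0.ne', hs]
  have : 2 * K = n * q ^ 2 := by rw [hq2]; field_simp
  rw [this]
  field_simp

/-- If every element of `F` is close to one of `N`, then the Rademacher averages are close. -/
theorem rademacher_le_add_of_approx (D : Fin n → S) {F N E : Set (S → ℝ)}
    (hN : N.Finite) (hE : E.Finite)
    (h : ∀ f ∈ F, ∃ g ∈ N, f - g ∈ E) :
    rademacher F D ≤ rademacher N D + rademacher E D := by
  rw [rademacher_eq, rademacher_eq, rademacher_eq, ← signMean_add]
  refine signMean_mono fun ε => ?_
  refine Real.iSup_le (fun f => ?_) (add_nonneg (Real.iSup_nonneg fun f => abs_nonneg _)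
    (Real.iSup_nonneg fun f => abs_nonneg _))
  obtain ⟨g, hg, hfg⟩ := h f.1 f.2
  have e : signedAvg D ε f.1 = signedAvg D ε g + signedAvg D ε (f.1 - g) := by
    rw [← signedAvg_add, add_sub_cancel]
  rw [e]
  exact (abs_add_le _ _).trans (add_le_add (le_iSup_abs_signedAvg hN D ε hg)
    (le_iSup_abs_signedAvg hE D ε hfg))

/-- Cauchy–Schwarz, with no entropy cost. It handles the remainder after the last chaining step and
the case of radius zero. -/
theorem rademacher_le_of_empSq_le (hn : 0 < n) (D : Fin n → S) {F : Set (S → ℝ)} {ρ : ℝ}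
    (hρ : 0 ≤ ρ) (hF : ∀ f ∈ F, empSq D f ≤ ρ ^ 2) : rademacher F D ≤ ρ := by
  rw [rademacher_eq, ← signMean_const (n := n) ρ]
  refine signMean_mono fun ε => Real.iSup_le (fun f => ?_) hρ
  exact (abs_signedAvg_le_sqrt hn D ε f).trans (Real.sqrt_le_iff.2 ⟨hρ, hF f f.2⟩)

/-- Maximal separated subsets are nets. -/
theorem exists_net (D : Fin n → S) (F : Finset (S → ℝ)) {κ : ℝ} (hκ : 0 < κ) :
    ∃ N ⊆ F, (∀ f ∈ N, ∀ g ∈ N, f ≠ g → κ ≤ empSq D (f - g)) ∧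
      ∀ f ∈ F, ∃ g ∈ N, empSq D (f - g) ≤ κ := by
  classical
  have hmax : ∀ Sep : Finset (S → ℝ) → Prop, Sep ∅ →
      ∃ N ⊆ F, Sep N ∧ ∀ M ⊆ F, Sep M → N ⊆ M → M ⊆ N := by
    intro Sep h0
    obtain ⟨N, hN⟩ := Finset.exists_maximal (s := F.powerset.filter Sep) ⟨∅, by simp [h0]⟩
    have hN1 := Finset.mem_filter.1 hN.1
    exact ⟨N, Finset.mem_powerset.1 hN1.1, hN1.2, fun M hM hS hNM =>
      hN.2 (Finset.mem_filter.2 ⟨Finset.mem_powerset.2 hM, hS⟩) hNM⟩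
  obtain ⟨N, hNF, hsep, hmaxN⟩ := hmax
    (fun N => ∀ f ∈ N, ∀ g ∈ N, f ≠ g → κ ≤ empSq D (f - g)) (by simp)
  refine ⟨N, hNF, hsep, fun f hf => ?_⟩
  by_contra! hcon
  have hsym : ∀ f g : S → ℝ, empSq D (f - g) = empSq D (g - f) := by
    intro f g
    unfold empSq
    congr 1
    refine Finset.sum_congr rfl fun i _ => ?_
    simp only [Pi.sub_apply]
    ring
  have hins : ∀ a ∈ insert f N, ∀ b ∈ insert f N, a ≠ b → κ ≤ empSq D (a - b) := by
    intro a ha b hb hab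
    rw [Finset.mem_insert] at ha hb
    rcases ha with rfl | ha <;> rcases hb with rfl | hb
    · exact absurd rfl hab
    · exact (hcon b hb).le
    · rw [hsym]; exact (hcon a ha).le
    · exact hsep a ha b hb hab
  have hfN := hmaxN _ (Finset.insert_subset hf hNF) hins (Finset.subset_insert f N)
    (Finset.mem_insert_self f N)
  have h0 : empSq D (f - f) = 0 := by simp [empSq]
  linarith [hcon f hfN]

/-- The constant of the chaining bound. -/
def chainConst (δ : ℝ) : ℝ := 2 * Real.sqrt 8 / (1 - 2 ^ (-(1 - δ)))

theorem two_rpow_lt_one {δ : ℝ} (hδ1 : δ < 1) : (2 : ℝ) ^ (-(1 - δ)) < 1 :=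
  Real.rpow_lt_one_of_one_lt_of_neg (by norm_num) (by linarith)

theorem chainConst_pos {δ : ℝ} (hδ1 : δ < 1) : 0 < chainConst δ := by
  have := two_rpow_lt_one hδ1
  unfold chainConst
  have h : 0 < 1 - (2 : ℝ) ^ (-(1 - δ)) := by linarith
  positivity

/-- Dudley's chaining bound for polynomial entropy. -/
theorem rademacher_le_chaining (hn : 0 < n) (D : Fin n → S) (F : Finset (S → ℝ))
    {δ A σ : ℝ} (hδ1 : δ < 1) (hA : 0 < A) (hσ : 0 < σ) (hσ1 : σ ≤ 1)
    (hF : ∀ f ∈ F, empSq D f ≤ σ ^ 2)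
    (hent : ∀ N ⊆ F, ∀ κ : ℝ, 0 < κ → κ ≤ 1 →
      (∀ f ∈ N, ∀ g ∈ N, f ≠ g → κ ≤ empSq D (f - g)) →
        Real.log (2 * N.card) ≤ 4 * A * κ ^ (-δ)) :
    rademacher (F : Set (S → ℝ)) D ≤ chainConst δ * Real.sqrt (A / n) * σ ^ (1 - δ) := by
  classical
  have hn' : (0 : ℝ) < n := by exact_mod_cast hn
  -- Dyadic radii. Nets and separation are measured by the squared distance `empSq`, hence at level
  -- `e j ^ 2`.
  set e : ℕ → ℝ := fun j => σ * (1 / 2) ^ j with he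
  have he0 : ∀ j, 0 < e j := fun j => by positivity
  have he1 : ∀ j, e j ≤ 1 := fun j =>
    mul_le_one₀ hσ1 (by positivity) (pow_le_one₀ (by norm_num) (by norm_num))
  choose N hNF hNsep hNnet using fun j => exists_net D F (κ := e j ^ 2) (by have := he0 j; positivity)
  -- The 8 is Massart's factor 2 times the 4 of the entropy bound.
  set Q : ℝ := Real.sqrt 8 * Real.sqrt (A / n) with hQ
  have hlink : ∀ j, Real.sqrt (2 * (4 * A * (e j ^ 2) ^ (-δ)) / n) = Q * (e j) ^ (-δ) := by
    intro j
    have h1 : (e j ^ 2) ^ (-δ) = (e j ^ (-δ)) ^ 2 := by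
      rw [← Real.rpow_natCast, ← Real.rpow_natCast, ← Real.rpow_mul (he0 j).le,
        ← Real.rpow_mul (he0 j).le]
      ring_nf
    rw [h1, hQ, ← Real.sqrt_mul (by norm_num), show 2 * (4 * A * (e j ^ (-δ)) ^ 2) / (n : ℝ) =
      8 * (A / n) * (e j ^ (-δ)) ^ 2 by ring, Real.sqrt_mul (by positivity),
      Real.sqrt_sq (Real.rpow_pos_of_pos (he0 j) _).le]
  have hent' : ∀ j, Real.log (2 * (N j).card) ≤ 4 * A * (e j ^ 2) ^ (-δ) := fun j =>
    hent (N j) (hNF j) _ (by have := he0 j; positivity)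
      (pow_le_one₀ (he0 j).le (he1 j)) (hNsep j)
  have hKpos : ∀ j, 0 < 4 * A * (e j ^ 2) ^ (-δ) := fun j => by
    have := Real.rpow_pos_of_pos (pow_pos (he0 j) 2) (-δ)
    positivity
  have hpow : ∀ j, e j * e j ^ (-δ) = e j ^ (1 - δ) := fun j => by
    rw [sub_eq_add_neg, Real.rpow_add (he0 j), Real.rpow_one]
  set q : ℝ := (2 : ℝ) ^ (-(1 - δ)) with hq
  have hq1 : q < 1 := two_rpow_lt_one hδ1
  have hq0 : 0 < q := by positivity
  have hepow : ∀ j, e j ^ (1 - δ) = σ ^ (1 - δ) * q ^ j := by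
    intro j
    rw [he, hq, Real.mul_rpow hσ.le (by positivity), ← Real.rpow_natCast, ← Real.rpow_natCast,
      ← Real.rpow_mul (by norm_num), ← Real.rpow_mul (by norm_num), one_div,
      Real.inv_rpow (by norm_num), ← Real.rpow_neg (by norm_num)]
    ring_nf
  have hbase : rademacher (N 0 : Set (S → ℝ)) D ≤ Q * σ ^ (1 - δ) := by
    have h := rademacher_le_of_card hn D (N 0) hσ (hKpos 0) (fun f hf => hF f (hNF 0 hf)) (hent' 0)
    rw [hlink 0] at h
    refine h.trans (le_of_eq ?_)
    have h0 : e 0 = σ := by simp [he]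
    have := hpow 0
    rw [h0] at this ⊢
    rw [← this]; ring
  have hstep : ∀ j, rademacher (N (j + 1) : Set (S → ℝ)) D ≤
      rademacher (N j : Set (S → ℝ)) D + 2 * (Q * σ ^ (1 - δ)) * q ^ (j + 1) := by
    intro j
    have hex : ∀ f : S → ℝ, ∃ g, f ∈ F → g ∈ N j ∧ empSq D (f - g) ≤ e j ^ 2 := fun f => by
      by_cases hf : f ∈ F
      · obtain ⟨g, hg⟩ := hNnet j f hf
        exact ⟨g, fun _ => hg⟩
      · exact ⟨f, fun h => absurd h hf⟩
    choose π hπ using hex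
    set E := (N (j + 1)).image fun f => f - π f with hE
    have h1 := rademacher_le_add_of_approx D (F := (N (j + 1) : Set (S → ℝ)))
      (N j).finite_toSet E.finite_toSet (fun f hf => ⟨π f, (hπ f (hNF _ hf)).1,
        Finset.mem_coe.2 (Finset.mem_image_of_mem _ hf)⟩)
    -- The links have radius `e j` and are no more numerous than the finer net. As `e j = 2 * e (j +
    -- 1)`, each step costs a term of a geometric series with ratio `q`.
    have h2 : rademacher (E : Set (S → ℝ)) D ≤ e j * (Q * e (j + 1) ^ (-δ)) := by
      rw [← hlink (j + 1)]
      refine rademacher_le_of_card hn D E (he0 j) (hKpos (j + 1)) ?_ ?_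
      · intro h hh
        obtain ⟨f, hf, rfl⟩ := Finset.mem_image.1 hh
        exact (hπ f (hNF _ hf)).2
      · rcases E.eq_empty_or_nonempty with h0 | hne
        · simp only [h0, Finset.card_empty, Nat.cast_zero, mul_zero, Real.log_zero]
          exact (hKpos _).le
        · have : (0 : ℝ) < E.card := by exact_mod_cast hne.card_pos
          refine (Real.log_le_log (by positivity) ?_).trans (hent' (j + 1))
          exact mul_le_mul_of_nonneg_left (Nat.cast_le.2 Finset.card_image_le) (by norm_num)
    have h3 : e j = 2 * e (j + 1) := by simp only [he, pow_succ]; ring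
    calc _ ≤ _ := h1
      _ ≤ rademacher (N j : Set (S → ℝ)) D + e j * (Q * e (j + 1) ^ (-δ)) := by gcongr
      _ = rademacher (N j : Set (S → ℝ)) D + 2 * Q * (e (j + 1) * e (j + 1) ^ (-δ)) := by
          rw [h3]; ring
      _ = _ := by rw [hpow, hepow]; ring
  have hQ0 : 0 ≤ Q * σ ^ (1 - δ) := by positivity
  have hsum : ∀ J, rademacher (N J : Set (S → ℝ)) D ≤
      2 * (Q * σ ^ (1 - δ)) * ∑ j ∈ Finset.range (J + 1), q ^ j := by
    intro J
    induction J with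
    | zero => simp; linarith
    | succ J ih =>
      rw [Finset.sum_range_succ, mul_add]
      exact (hstep J).trans (by linarith)
  have hgeom : ∀ J, ∑ j ∈ Finset.range (J + 1), q ^ j ≤ 1 / (1 - q) := by
    intro J
    have h1 := (summable_geometric_of_lt_one hq0.le hq1).sum_le_tsum (Finset.range (J + 1))
      (fun j _ => by positivity)
    rwa [tsum_geometric_of_lt_one hq0.le hq1, ← one_div] at h1
  have hfin : ∀ J : ℕ, rademacher (F : Set (S → ℝ)) D ≤
      chainConst δ * Real.sqrt (A / n) * σ ^ (1 - δ) + σ * (1 / 2) ^ J := by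
    intro J
    have hex : ∀ f : S → ℝ, ∃ g, f ∈ F → g ∈ N J ∧ empSq D (f - g) ≤ e J ^ 2 := fun f => by
      by_cases hf : f ∈ F
      · obtain ⟨g, hg⟩ := hNnet J f hf
        exact ⟨g, fun _ => hg⟩
      · exact ⟨f, fun h => absurd h hf⟩
    choose π hπ using hex
    set E := F.image fun f => f - π f with hE
    have h1 := rademacher_le_add_of_approx D (F := (F : Set (S → ℝ)))
      (N J).finite_toSet E.finite_toSet (fun f hf => ⟨π f, (hπ f hf).1,
        Finset.mem_coe.2 (Finset.mem_image_of_mem _ hf)⟩)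
    have h2 : rademacher (E : Set (S → ℝ)) D ≤ e J := by
      refine rademacher_le_of_empSq_le hn D (he0 J).le fun h hh => ?_
      obtain ⟨f, hf, rfl⟩ := Finset.mem_image.1 (Finset.mem_coe.1 hh)
      exact (hπ f hf).2
    refine h1.trans (add_le_add ?_ h2)
    refine (hsum J).trans ?_
    refine (mul_le_mul_of_nonneg_left (hgeom J) (by positivity)).trans (le_of_eq ?_)
    rw [chainConst, hQ, ← hq]
    ring
  -- The remainder below scale `e J` vanishes as `J` grows, while the chaining part is bounded
  -- uniformly in `J`.
  have hlim : Filter.Tendsto (fun J : ℕ => chainConst δ * Real.sqrt (A / n) * σ ^ (1 - δ) +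
      σ * (1 / 2 : ℝ) ^ J) Filter.atTop
      (nhds (chainConst δ * Real.sqrt (A / n) * σ ^ (1 - δ) + σ * 0)) :=
    ((tendsto_pow_atTop_nhds_zero_of_lt_one (by norm_num) (by norm_num)).const_mul σ).const_add _
  rw [mul_zero, add_zero] at hlim
  exact ge_of_tendsto' hlim hfin

end Empirical

/-! ### The variance bound -/

section Variance

variable {d : ℕ}

theorem loss_mem_Icc (y t : ℤˣ) : 0 ≤ loss y t ∧ loss y t ≤ 1 := by
  unfold loss
  split_ifs <;> norm_num

theorem measurable_lossOf {g : Cube d → ℤˣ} (hg : Measurable g) : Measurable (lossOf g) := by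
  unfold lossOf loss
  refine Measurable.ite ?_ measurable_const measurable_const
  exact (measurableSet_eq_fun measurable_snd (hg.comp measurable_fst)).compl


theorem integrable_lossOf (P : Measure (Cube d × ℤˣ)) [IsProbabilityMeasure P]
    {g : Cube d → ℤˣ} (hg : Measurable g) : Integrable (lossOf g) P :=
  Integrable.of_bound (measurable_lossOf hg).aestronglyMeasurable 1
    (Filter.Eventually.of_forall fun z => by
      rw [Real.norm_eq_abs, abs_le]
      have := loss_mem_Icc z.2 (g z.1)
      unfold lossOf
      constructor <;> linarith)

theorem measurable_posterior (P : Measure (Cube d × ℤˣ)) [IsProbabilityMeasure P] :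
    Measurable (posterior P) :=
  (Kernel.measurable_coe P.condKernel (MeasurableSet.singleton 1)).ennreal_toReal

theorem posterior_mem_Icc (P : Measure (Cube d × ℤˣ)) [IsProbabilityMeasure P]
    (x : Cube d) : 0 ≤ posterior P x ∧ posterior P x ≤ 1 :=
  ⟨measureReal_nonneg, measureReal_le_one⟩

theorem integral_lossOf_condKernel (P : Measure (Cube d × ℤˣ)) [IsProbabilityMeasure P]
    (g : Cube d → ℤˣ) (x : Cube d) :
    ∫ y, lossOf g (x, y) ∂(P.condKernel x) =
      if g x = 1 then 1 - posterior P x else posterior P x := by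
  have h1 : (P.condKernel x).real {-1} = 1 - posterior P x := by
    have h : ({-1} : Set ℤˣ) = {1}ᶜ := by
      ext y
      rcases Int.units_eq_one_or y with rfl | rfl <;> simp
    rw [h, probReal_compl_eq_one_sub (MeasurableSet.singleton 1)]
    rfl
  rw [integral_fintype .of_finite, UnitsInt.univ, Finset.sum_pair (by decide), h1]
  change posterior P x • _ + _ = _
  rcases Int.units_eq_one_or (g x) with h | h <;> simp [lossOf, loss, h]

theorem risk_eq (P : Measure (Cube d × ℤˣ)) [IsProbabilityMeasure P]
    {g : Cube d → ℤˣ} (hg : Measurable g) :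
    risk P g = ∫ x, (if g x = 1 then 1 - posterior P x else posterior P x) ∂P.fst := by
  unfold risk
  rw [← Measure.integral_condKernel (integrable_lossOf P hg)]
  exact integral_congr_ae (Filter.Eventually.of_forall fun x => integral_lossOf_condKernel P g x)

theorem bayesRisk_le (P : Measure (Cube d × ℤˣ)) {g : Cube d → ℤˣ} (hg : Measurable g) : bayesRisk P ≤ risk P g :=
  ciInf_le (f := fun f : {f : Cube d → ℤˣ // Measurable f} => risk P f.1)
    ⟨0, by
      rintro _ ⟨f, rfl⟩
      exact integral_nonneg fun z => (loss_mem_Icc _ _).1⟩ ⟨g, hg⟩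

open Classical in
/-- The classifier that predicts the more probable label. -/
def plugIn (P : Measure (Cube d × ℤˣ)) [IsProbabilityMeasure P]
    (x : Cube d) : ℤˣ := if 1 / 2 ≤ posterior P x then 1 else -1

theorem measurable_plugIn (P : Measure (Cube d × ℤˣ)) [IsProbabilityMeasure P] :
    Measurable (plugIn P) :=
  Measurable.ite (measurableSet_le measurable_const (measurable_posterior P))
    measurable_const measurable_const

/-- At a point of disagreement the conditional error probabilities are `posterior` and its
complement, so choosing the less likely label costs exactly `|2 * posterior P x - 1|`. -/
theorem risk_sub_risk_plugIn (P : Measure (Cube d × ℤˣ)) [IsProbabilityMeasure P]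
    {g : Cube d → ℤˣ} (hg : Measurable g) :
    risk P g - risk P (plugIn P) =
      ∫ x, {x | g x ≠ plugIn P x}.indicator (fun x => |2 * posterior P x - 1|) x ∂P.fst := by
  have hint : ∀ f : Cube d → ℤˣ, Measurable f →
      Integrable (fun x => if f x = 1 then 1 - posterior P x else posterior P x) P.fst := by
    intro f hf
    refine Integrable.of_bound (Measurable.ite (hf (MeasurableSet.singleton 1))
      (measurable_const.sub (measurable_posterior P))
      (measurable_posterior P)).aestronglyMeasurable 1 (Filter.Eventually.of_forall fun x => ?_)
    have := posterior_mem_Icc P x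
    rw [Real.norm_eq_abs, abs_le]
    split_ifs <;> constructor <;> linarith
  rw [risk_eq P hg, risk_eq P (measurable_plugIn P),
    ← integral_sub (hint g hg) (hint _ (measurable_plugIn P))]
  refine integral_congr_ae (Filter.Eventually.of_forall fun x => ?_)
  simp only [Set.indicator_apply, Set.mem_ofPred_eq]
  have hne : ¬ ((-1 : ℤˣ) = 1) := by decide
  by_cases h : 1 / 2 ≤ posterior P x
  · have hp : plugIn P x = 1 := if_pos h
    rw [abs_of_nonneg (by linarith)]
    simp only [hp]
    rcases Int.units_eq_one_or (g x) with h1 | h1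
    · simp [h1]
    · simp [h1, hne]; ring
  · have hp : plugIn P x = -1 := if_neg h
    rw [abs_of_neg (by linarith)]
    simp only [hp]
    rcases Int.units_eq_one_or (g x) with h1 | h1
    · simp [h1, hne, Ne.symm hne]; ring
    · simp [h1, hne]

/-- Disagreement occurs either where the margin is at most `h`, or where it costs at least `h`;
Markov's inequality bounds the second part. Optimality of `plugIn` is not needed, only that its risk
is at least `bayesRisk`. -/
theorem measure_ne_plugIn_le_add (P : Measure (Cube d × ℤˣ)) [IsProbabilityMeasure P]
    {g : Cube d → ℤˣ} (hg : Measurable g) {r h : ℝ}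
    (hgr : risk P g - bayesRisk P ≤ r) (hh : 0 < h) :
    P.fst.real {x | g x ≠ plugIn P x} ≤
      P.fst.real {x | |2 * posterior P x - 1| ≤ h} + r / h := by
  have hm : Measurable fun x => |2 * posterior P x - 1| :=
    (((measurable_posterior P).const_mul 2).sub_const 1).abs
  have hms : MeasurableSet {x | g x ≠ plugIn P x} :=
    (measurableSet_eq_fun hg (measurable_plugIn P)).compl
  have hsub : {x | g x ≠ plugIn P x} ⊆ {x | |2 * posterior P x - 1| ≤ h} ∪
      {x | h ≤ {x | g x ≠ plugIn P x}.indicator (fun x => |2 * posterior P x - 1|) x} := by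
    intro x hx
    by_cases hxh : |2 * posterior P x - 1| ≤ h
    · exact Or.inl hxh
    · refine Or.inr ?_
      change h ≤ _
      rw [Set.indicator_of_mem hx]
      exact (not_le.1 hxh).le
  refine (measureReal_mono hsub).trans ((measureReal_union_le _ _).trans ?_)
  gcongr
  rw [le_div_iff₀ hh, mul_comm]
  refine (mul_meas_ge_le_integral_of_nonneg (Filter.Eventually.of_forall fun x =>
    Set.indicator_nonneg (fun _ _ => abs_nonneg _) x) ?_ h).trans ?_
  · refine Integrable.of_bound (hm.indicator hms).aestronglyMeasurable 1
      (Filter.Eventually.of_forall fun x => ?_)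
    have := posterior_mem_Icc P x
    rw [Real.norm_eq_abs, Set.indicator_apply]
    split_ifs
    · rw [abs_abs, abs_le]
      constructor <;> linarith
    · simp
  · rw [← risk_sub_risk_plugIn P hg]
    linarith [bayesRisk_le P (measurable_plugIn P)]

theorem measure_ne_plugIn_le (P : Measure (Cube d × ℤˣ)) [IsProbabilityMeasure P]
    {g : Cube d → ℤˣ} (hg : Measurable g) {α : ℝ≥0∞} {c : ℝ}
    (hc : 0 < c) (hP : HasNoiseExponent P α c) {r : ℝ} (hr : 0 < r)
    (hgr : risk P g - bayesRisk P ≤ r) :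
    P.fst.real {x | g x ≠ plugIn P x} ≤ (2 + c) * r ^ varExponent α := by
  by_cases hα : α = ∞
  -- Any fixed `h` in `(0, 1)` works here, since the small-margin set is null.
  · have h := measure_ne_plugIn_le_add P hg hgr (h := 1 / 2) (by norm_num)
    rw [hP.2 hα (1 / 2) (by norm_num) (by norm_num)] at h
    rw [varExponent, if_pos hα, Real.rpow_one]
    nlinarith
  · set a := α.toReal with ha
    have ha0 : 0 ≤ a := ENNReal.toReal_nonneg
    -- The margin level `h = r^(1/(1+a))` balances `h^a` against `r/h`.
    have hh : 0 < r ^ (1 / (1 + a)) := Real.rpow_pos_of_pos hr _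
    have h := measure_ne_plugIn_le_add P hg hgr hh
    have h1 := hP.1 hα _ hh.le
    rw [← Real.rpow_mul hr.le] at h1
    rw [varExponent, if_neg hα, ← ha]
    have e1 : 1 / (1 + a) * a = a / (1 + a) := by ring
    have e2 : r / r ^ (1 / (1 + a)) = r ^ (a / (1 + a)) := by
      rw [div_eq_iff hh.ne', ← Real.rpow_add hr]
      have : a / (1 + a) + 1 / (1 + a) = 1 := by
        rw [← add_div, add_comm, div_self (by positivity)]
      rw [this, Real.rpow_one]
    rw [e2] at h
    rw [← ha, e1] at h1
    have := Real.rpow_pos_of_pos hr (a / (1 + a))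
    linarith

theorem lossOf_sub_sq (f g : Cube d → ℤˣ) (z : Cube d × ℤˣ) :
    (lossOf g - lossOf f) z ^ 2 = if g z.1 = f z.1 then 0 else 1 := by
  simp only [Pi.sub_apply, lossOf, loss]
  rcases Int.units_eq_one_or (g z.1) with h1 | h1 <;>
  rcases Int.units_eq_one_or (f z.1) with h2 | h2 <;>
  rcases Int.units_eq_one_or z.2 with h3 | h3 <;>
  simp [h1, h2, h3]

/-- The squared loss difference is the indicator of disagreement. Comparing both `g` and the
arbitrary Bayes decision `f` with `plugIn` costs the factor 2. -/
theorem integral_lossOf_sub_sq_le (P : Measure (Cube d × ℤˣ)) [IsProbabilityMeasure P]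
    {g f : Cube d → ℤˣ} (hg : Measurable g)
    (hf : IsBayesDecision P f) {α : ℝ≥0∞} {c : ℝ}
    (hc : 0 < c) (hP : HasNoiseExponent P α c) {r : ℝ} (hr : 0 < r)
    (hgr : risk P g - bayesRisk P ≤ r) :
    ∫ z, (lossOf g - lossOf f) z ^ 2 ∂P ≤ 2 * (2 + c) * r ^ varExponent α := by
  have hms : MeasurableSet {x | g x ≠ f x} := (measurableSet_eq_fun hg hf.1).compl
  have h1 : ∫ z, (lossOf g - lossOf f) z ^ 2 ∂P = P.fst.real {x | g x ≠ f x} := by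
    have : (fun z => (lossOf g - lossOf f) z ^ 2) =
        (Prod.fst ⁻¹' {x | g x ≠ f x}).indicator fun _ => (1 : ℝ) := by
      classical
      funext z
      rw [lossOf_sub_sq, Set.indicator_apply]
      by_cases h : g z.1 = f z.1 <;> simp [h]
    rw [this, integral_indicator_const _ (measurable_fst hms), smul_eq_mul, mul_one,
      measureReal_def, measureReal_def, Measure.fst_apply hms]
  rw [h1]
  have hsub : {x | g x ≠ f x} ⊆ {x | g x ≠ plugIn P x} ∪ {x | f x ≠ plugIn P x} := by
    intro x hx
    by_cases h : g x = plugIn P x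
    · exact Or.inr fun h' => hx (h.trans h'.symm)
    · exact Or.inl h
  refine (measureReal_mono hsub).trans ((measureReal_union_le _ _).trans ?_)
  have h2 := measure_ne_plugIn_le P hg hc hP hr hgr
  have h3 := measure_ne_plugIn_le P hf.1 hc hP hr (by rw [hf.2]; linarith)
  linarith

end Variance

/-! ### Symmetrization -/

section Symmetrization

variable {S ι : Type*} {n : ℕ}

theorem measurable_signedAvg [MeasurableSpace S] {f : S → ℝ} (hf : Measurable f) (ε : Fin n → ℤˣ) :
    Measurable fun D : Fin n → S => signedAvg D ε f :=
  (Finset.measurable_sum _ fun i _ => (hf.comp (measurable_pi_apply i)).const_mul _).const_mul _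

theorem abs_signedAvg_le_one (D : Fin n → S) (ε : Fin n → ℤˣ) {f : S → ℝ}
    (hf : ∀ z, |f z| ≤ 1) : |signedAvg D ε f| ≤ 1 := by
  rcases Nat.eq_zero_or_pos n with rfl | hn
  · simp [signedAvg]
  · refine (abs_signedAvg_le_sqrt hn D ε f).trans (Real.sqrt_le_one.2 ?_)
    have hn' : (0 : ℝ) < n := by exact_mod_cast hn
    unfold empSq
    rw [inv_mul_le_iff₀ hn', mul_one]
    calc ∑ i, f (D i) ^ 2 ≤ ∑ _i : Fin n, (1 : ℝ) :=
          Finset.sum_le_sum fun i _ => (sq_le_one_iff_abs_le_one _).2 (hf _)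
      _ = n := by simp

theorem iSup_mem_Icc_of_bound [Finite ι] [Nonempty ι] {F : ι → ℝ} {a b : ℝ} (h : ∀ i, a ≤ F i ∧ F i ≤ b) :
    a ≤ ⨆ i, F i ∧ ⨆ i, F i ≤ b := by
  obtain ⟨i⟩ := ‹Nonempty ι›
  exact ⟨(h i).1.trans (le_ciSup (Set.finite_range F).bddAbove i), ciSup_le fun i => (h i).2⟩

theorem integral_comp_of_measurePreserving {X Y : Type*} [MeasurableSpace X] [MeasurableSpace Y]
    {μ : Measure X} {ν : Measure Y} {f : X → Y} (hf : MeasurePreserving f μ ν) {g : Y → ℝ}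
    (hg : Measurable g) : ∫ x, g (f x) ∂μ = ∫ y, g y ∂ν := by
  rw [← hf.map_eq, integral_map hf.measurable.aemeasurable hg.aestronglyMeasurable]

/-- Symmetrization for a finite class of bounded functions. -/
theorem integral_iSup_avg_le [MeasurableSpace S] [Finite ι] [Nonempty ι] (hn : 0 < n) (P : Measure S) [IsProbabilityMeasure P]
    (F : ι → S → ℝ) (hF : ∀ i, Measurable (F i)) (hF1 : ∀ i z, |F i z| ≤ 1) {v : ℝ}
    (hv : ∀ i, ∫ z, F i z ∂P ≤ v) :
    ∫ D : Fin n → S, ⨆ j, signedAvg D 1 (F j) ∂(Measure.pi fun _ => P) ≤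
      v + 2 * ∫ D : Fin n → S, signMean (fun ε => ⨆ j, |signedAvg D ε (F j)|)
        ∂(Measure.pi fun _ => P) := by
  have hn' : (0 : ℝ) < n := by exact_mod_cast hn
  set μ : Measure (Fin n → S) := Measure.pi fun _ => P with hμ
  set W : Measure (Fin n → S × S) := Measure.pi fun _ => P.prod P with hW
  have hbdd : ∀ φ : ι → ℝ, BddAbove (Set.range φ) := fun φ => (Set.finite_range φ).bddAbove
  have habs : ∀ (D : Fin n → S) (ε : Fin n → ℤˣ) (j : ι),
      -1 ≤ signedAvg D ε (F j) ∧ signedAvg D ε (F j) ≤ 1 := fun D ε j =>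
    abs_le.1 (abs_signedAvg_le_one D ε (hF1 j))
  have hmeas : ∀ (ε : Fin n → ℤˣ) (j : ι), Measurable fun D : Fin n → S => signedAvg D ε (F j) :=
    fun ε j => measurable_signedAvg (hF j) ε
  have hint_abs : ∀ ε : Fin n → ℤˣ, Integrable (fun D => ⨆ j, |signedAvg D ε (F j)|) μ := by
    intro ε
    refine Integrable.of_bound (Measurable.iSup fun j =>
      (hmeas ε j).abs).aestronglyMeasurable 1 (Filter.Eventually.of_forall fun D => ?_)
    rw [Real.norm_eq_abs, abs_le]
    exact iSup_mem_Icc_of_bound fun j => ⟨by linarith [abs_nonneg (signedAvg D ε (F j))],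
      abs_signedAvg_le_one D ε (hF1 j)⟩
  -- the signed difference of two samples
  set Ψ : (Fin n → ℤˣ) → (Fin n → S) × (Fin n → S) → ℝ := fun ε DD =>
    ⨆ j, (signedAvg DD.1 ε (F j) - signedAvg DD.2 ε (F j)) with hΨ
  have hΨmeas : ∀ ε, Measurable (Ψ ε) := fun ε => Measurable.iSup fun j =>
    ((hmeas ε j).comp measurable_fst).sub ((hmeas ε j).comp measurable_snd)
  have hΨbd : ∀ ε DD, ‖Ψ ε DD‖ ≤ 2 := fun ε DD => by
    rw [Real.norm_eq_abs, abs_le]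
    refine iSup_mem_Icc_of_bound fun j => ?_
    have h1 := habs DD.1 ε j
    have h2 := habs DD.2 ε j
    constructor <;> linarith
  have hΨint : Integrable (Ψ 1) (μ.prod μ) :=
    Integrable.of_bound (hΨmeas 1).aestronglyMeasurable 2 (Filter.Eventually.of_forall (hΨbd 1))
  have hFint : ∀ j, Integrable (F j) P := fun j =>
    Integrable.of_bound (hF j).aestronglyMeasurable 1
      (Filter.Eventually.of_forall fun z => hF1 j z)
  have havg_int : ∀ j, Integrable (fun D : Fin n → S => signedAvg D 1 (F j)) μ := fun j =>
    Integrable.of_bound (hmeas 1 j).aestronglyMeasurable 1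
      (Filter.Eventually.of_forall fun D => abs_signedAvg_le_one D 1 (hF1 j))
  have havg : ∀ j, ∫ D : Fin n → S, signedAvg D 1 (F j) ∂μ = ∫ z, F j z ∂P := by
    intro j
    have hcoord : ∀ i : Fin n, ∫ D : Fin n → S, F j (D i) ∂μ = ∫ z, F j z ∂P := fun i =>
      integral_comp_of_measurePreserving (measurePreserving_eval (fun _ : Fin n => P) i) (hF j)
    have hci : ∀ i : Fin n, Integrable (fun D : Fin n → S => F j (D i)) μ := fun i =>
      (measurePreserving_eval (fun _ : Fin n => P) i).integrable_comp_of_integrable (hFint j)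
    unfold signedAvg
    simp only [Pi.one_apply, Units.val_one, Int.cast_one, one_mul]
    rw [integral_const_mul, integral_finsetSum _ fun i _ => hci i]
    simp only [hcoord, Finset.sum_const, Finset.card_univ, Fintype.card_fin, nsmul_eq_mul]
    rw [inv_mul_cancel_left₀ hn'.ne']
  have hpoint : ∀ D : Fin n → S, ⨆ j, signedAvg D 1 (F j) ≤ v + ∫ D', Ψ 1 (D, D') ∂μ := by
    intro D
    refine ciSup_le fun j => ?_
    have h1 : signedAvg D 1 (F j) - ∫ z, F j z ∂P ≤ ∫ D', Ψ 1 (D, D') ∂μ := by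
      have e : signedAvg D 1 (F j) - ∫ z, F j z ∂P =
          ∫ D' : Fin n → S, (signedAvg D 1 (F j) - signedAvg D' 1 (F j)) ∂μ := by
        rw [integral_sub (integrable_const _) (havg_int j), havg, integral_const]
        simp
      rw [e]
      refine integral_mono ((integrable_const _).sub (havg_int j)) ?_ fun D' =>
        le_ciSup (f := fun j => signedAvg D 1 (F j) - signedAvg D' 1 (F j)) (hbdd _) j
      exact Integrable.of_bound
        ((hΨmeas 1).comp measurable_prodMk_left).aestronglyMeasurable 2
        (Filter.Eventually.of_forall fun D' => hΨbd 1 _)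
    linarith [hv j]
  have hstep1 : ∫ D : Fin n → S, ⨆ j, signedAvg D 1 (F j) ∂μ ≤
      v + ∫ DD, Ψ 1 DD ∂(μ.prod μ) := by
    rw [integral_prod _ hΨint]
    have : ∫ D : Fin n → S, (v + ∫ D', Ψ 1 (D, D') ∂μ) ∂μ =
        v + ∫ D, ∫ D', Ψ 1 (D, D') ∂μ ∂μ := by
      rw [integral_add (integrable_const _) hΨint.integral_prod_left, integral_const]
      simp
    rw [← this]
    refine integral_mono ?_ ((integrable_const _).add hΨint.integral_prod_left) hpoint
    refine Integrable.of_bound (Measurable.iSup fun j => hmeas 1 j).aestronglyMeasurable 1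
      (Filter.Eventually.of_forall fun D => ?_)
    rw [Real.norm_eq_abs, abs_le]
    exact iSup_mem_Icc_of_bound fun j => habs D 1 j
  -- pairs of samples as samples of pairs
  have hpair : MeasurePreserving
      (fun w : Fin n → S × S => ((fun i => (w i).1), (fun i => (w i).2))) W (μ.prod μ) :=
    measurePreserving_arrowProdEquivProdArrow S S (Fin n) (fun _ => P) fun _ => P
  -- Exchanging the two samples at the indices with `ε i = -1` preserves the product measure and
  -- inserts the signs.
  have hsym : ∀ ε : Fin n → ℤˣ, ∫ DD, Ψ 1 DD ∂(μ.prod μ) = ∫ DD, Ψ ε DD ∂(μ.prod μ) := by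
    intro ε
    set τ : (Fin n → S × S) → (Fin n → S × S) :=
      fun w i => (if ε i = 1 then id else Prod.swap) (w i) with hτ
    have hτm : MeasurePreserving τ W W := by
      refine measurePreserving_pi (fun _ => P.prod P) (fun _ => P.prod P) fun i => ?_
      split_ifs
      · exact MeasurePreserving.id _
      · exact Measure.measurePreserving_swap
    rw [← integral_comp_of_measurePreserving hpair (hΨmeas 1),
      ← integral_comp_of_measurePreserving hpair (hΨmeas ε)]
    refine Eq.trans ?_
      (integral_comp_of_measurePreserving hτm ((hΨmeas ε).comp hpair.measurable))
    refine integral_congr_ae (Filter.Eventually.of_forall fun w => ?_)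
    simp only [hΨ]
    congr 1
    funext j
    unfold signedAvg
    rw [← mul_sub, ← mul_sub, ← Finset.sum_sub_distrib, ← Finset.sum_sub_distrib]
    congr 1
    refine Finset.sum_congr rfl fun i _ => ?_
    rcases Int.units_eq_one_or (ε i) with h | h
    · simp [hτ, h]
    · have : ¬ ((-1 : ℤˣ) = 1) := by decide
      simp [hτ, h, this]
      ring
  have hbound : ∀ ε : Fin n → ℤˣ, ∫ DD, Ψ ε DD ∂(μ.prod μ) ≤
      2 * ∫ D : Fin n → S, ⨆ j, |signedAvg D ε (F j)| ∂μ := by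
    intro ε
    have i1 := (measurePreserving_fst (μ := μ) (ν := μ)).integrable_comp_of_integrable (hint_abs ε)
    have i2 := (measurePreserving_snd (μ := μ) (ν := μ)).integrable_comp_of_integrable (hint_abs ε)
    have hm : Measurable fun D : Fin n → S => ⨆ j, |signedAvg D ε (F j)| :=
      Measurable.iSup fun j => (hmeas ε j).abs
    calc ∫ DD, Ψ ε DD ∂(μ.prod μ)
        ≤ ∫ DD : (Fin n → S) × (Fin n → S), ((⨆ j, |signedAvg DD.1 ε (F j)|) +
            ⨆ j, |signedAvg DD.2 ε (F j)|) ∂(μ.prod μ) := by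
          refine integral_mono (Integrable.of_bound (hΨmeas ε).aestronglyMeasurable 2
            (Filter.Eventually.of_forall (hΨbd ε))) (i1.add i2) fun DD => ciSup_le fun j => ?_
          have h1 := le_ciSup (f := fun j => |signedAvg DD.1 ε (F j)|) (hbdd _) j
          have h2 := le_ciSup (f := fun j => |signedAvg DD.2 ε (F j)|) (hbdd _) j
          have h3 := le_abs_self (signedAvg DD.1 ε (F j))
          have h4 := neg_abs_le (signedAvg DD.2 ε (F j))
          linarith
      _ = 2 * ∫ D : Fin n → S, ⨆ j, |signedAvg D ε (F j)| ∂μ := by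
          have j1 := integral_comp_of_measurePreserving
            (measurePreserving_fst (μ := μ) (ν := μ)) hm
          have j2 := integral_comp_of_measurePreserving
            (measurePreserving_snd (μ := μ) (ν := μ)) hm
          refine (integral_add i1 i2).trans ?_
          simp only [Function.comp_apply]
          rw [j1, j2]
          ring
  have hfinal : ∫ DD, Ψ 1 DD ∂(μ.prod μ) ≤
      2 * ∫ D : Fin n → S, signMean (fun ε => ⨆ j, |signedAvg D ε (F j)|) ∂μ := by
    have e : ∫ D : Fin n → S, signMean (fun ε => ⨆ j, |signedAvg D ε (F j)|) ∂μ =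
        signMean fun ε => ∫ D : Fin n → S, ⨆ j, |signedAvg D ε (F j)| ∂μ := by
      unfold signMean
      rw [integral_const_mul, integral_finsetSum _ fun ε _ => hint_abs ε]
    rw [e, ← signMean_const_mul, ← signMean_const (n := n) (∫ DD, Ψ 1 DD ∂(μ.prod μ))]
    refine signMean_mono fun ε => ?_
    rw [hsym ε]
    exact hbound ε
  linarith

/-- Multiplying all functions by a common sign does not change the Rademacher average. -/
theorem signMean_iSup_sign_mul (D : Fin n → S) (F : ι → S → ℝ) (s : S → ℤˣ) :
    signMean (fun ε => ⨆ j, |signedAvg D ε (fun z => ((s z : ℤ) : ℝ) * F j z)|) =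
      signMean fun ε => ⨆ j, |signedAvg D ε (F j)| := by
  unfold signMean
  congr 1
  refine Fintype.sum_equiv (Equiv.mulRight fun i => s (D i)) _ _ fun ε => ?_
  congr 1
  funext j
  unfold signedAvg
  simp [mul_assoc]

end Symmetrization

/-! ### The localized classes of trees -/

section Local

variable {d k : ℕ} {P : Measure (Cube d × ℤˣ)} {Z : Fin k → SplittingPolicy d} {lam r : ℝ}

theorem exists_mem_trees_numSplits {g : Cube d → ℤˣ} (hg : g ∈ treeClass Z) :
    ∃ ℓ, g ∈ (Z ℓ).trees (numSplits Z g) := by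
  obtain ⟨ℓ, p, h⟩ := hg
  exact Nat.sInf_mem (s := {p | ∃ ℓ, g ∈ (Z ℓ).trees p}) ⟨p, ℓ, h⟩

theorem measurable_of_mem_treeClass {g : Cube d → ℤˣ} (hg : g ∈ treeClass Z) : Measurable g := by
  obtain ⟨ℓ, p, h⟩ := hg
  exact ((Z ℓ).isGuillotine_of_mem_trees h).measurable

theorem regExcessRisk_nonneg (hlam : 0 < lam) {g : Cube d → ℤˣ} (hg : g ∈ treeClass Z) :
    0 ≤ regExcessRisk P Z lam g := by
  have := bayesRisk_le P (measurable_of_mem_treeClass hg)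
  have : 0 ≤ lam * (numSplits Z g : ℝ) ^ 2 := by positivity
  unfold regExcessRisk
  linarith

theorem numSplits_le (hlam : 0 < lam) {g : Cube d → ℤˣ} (hg : g ∈ localTrees P Z lam r) :
    numSplits Z g ≤ ⌊Real.sqrt (r / lam)⌋₊ := by
  have h1 := bayesRisk_le P (measurable_of_mem_treeClass hg.1)
  have h2 := hg.2
  unfold regExcessRisk at h2
  refine Nat.le_floor (Real.le_sqrt_of_sq_le ?_)
  rw [le_div_iff₀ hlam]
  linarith

theorem finite_localTrees (hlam : 0 < lam) : (localTrees P Z lam r).Finite := by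
  refine (Set.finite_iUnion fun ℓ : Fin k => Set.finite_iUnion
    fun p : Fin (⌊Real.sqrt (r / lam)⌋₊ + 1) => (Z ℓ).trees_finite p).subset fun g hg => ?_
  obtain ⟨ℓ, h⟩ := exists_mem_trees_numSplits hg.1
  exact Set.mem_iUnion.2 ⟨ℓ, Set.mem_iUnion.2
    ⟨⟨_, Nat.lt_succ_of_le (numSplits_le hlam hg)⟩, h⟩⟩

theorem isGuillotine_of_mem_localTrees (hd : 0 < d) (hlam : 0 < lam) {g : Cube d → ℤˣ}
    (hg : g ∈ localTrees P Z lam r) : IsGuillotine ⌊Real.sqrt (r / lam)⌋₊ g := by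
  obtain ⟨ℓ, h⟩ := exists_mem_trees_numSplits hg.1
  exact ((Z ℓ).isGuillotine_of_mem_trees h).mono hd (numSplits_le hlam hg)

theorem excessRisk_le_of_mem_localTrees (hlam : 0 < lam) {g : Cube d → ℤˣ}
    (hg : g ∈ localTrees P Z lam r) : risk P g - bayesRisk P ≤ r := by
  have h2 := hg.2
  have : 0 ≤ lam * (numSplits Z g : ℝ) ^ 2 := by positivity
  unfold regExcessRisk at h2
  linarith

theorem nonempty_treeClass (hk : 0 < k) : (treeClass Z).Nonempty :=
  ⟨fun _ => 1, ⟨0, hk⟩, 0, ((Z _).mem_trees_iff 0 _).2 ⟨fun _ => 1, rfl⟩⟩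

theorem nonempty_localTrees (hk : 0 < k) (hr : rStar P Z lam < r) :
    (localTrees P Z lam r).Nonempty := by
  have : Nonempty (treeClass Z) := (nonempty_treeClass hk).to_subtype
  obtain ⟨g, hg⟩ := exists_lt_of_ciInf_lt hr
  exact ⟨g.1, g.2, hg.le⟩

theorem pos_of_rStar_lt (hk : 0 < k) (hlam : 0 < lam) (hr : rStar P Z lam < r) : 0 < r := by
  have : Nonempty (treeClass Z) := (nonempty_treeClass hk).to_subtype
  obtain ⟨g, hg⟩ := exists_lt_of_ciInf_lt hr
  exact (regExcessRisk_nonneg hlam g.2).trans_lt hg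

variable {fstar : Cube d → ℤˣ}

theorem lossDiffs_eq_image :
    lossDiffs P Z fstar lam r = (fun g => lossOf g - lossOf fstar) '' localTrees P Z lam r := by
  ext h
  exact exists_congr fun g => and_congr_right fun _ => eq_comm

theorem abs_lossOf_sub_le_one (g f : Cube d → ℤˣ) (z : Cube d × ℤˣ) :
    |(lossOf g - lossOf f) z| ≤ 1 := by
  rw [← sq_le_one_iff_abs_le_one, lossOf_sub_sq]
  split_ifs <;> norm_num

theorem empSq_lossOf_sub {n : ℕ} (D : Fin n → Cube d × ℤˣ) (g f : Cube d → ℤˣ) :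
    empSq D (lossOf g - lossOf f) =
      (n : ℝ)⁻¹ * (n - (Finset.univ.filter fun i => g (D i).1 = f (D i).1).card) := by
  unfold empSq
  congr 1
  simp only [lossOf_sub_sq]
  have : ∀ i, (if g (D i).1 = f (D i).1 then (0 : ℝ) else 1) =
      1 - if g (D i).1 = f (D i).1 then 1 else 0 := fun i => by split_ifs <;> norm_num
  simp only [this, Finset.sum_sub_distrib, Finset.sum_boole]
  simp

/-- The chaining bound for the localized classes. -/
theorem rademacher_lossDiffs_le {n : ℕ} (hd : 0 < d) (hn : 0 < n) (hlam : 0 < lam)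
    (D : Fin n → Cube d × ℤˣ) {δ A σ : ℝ} (hδ : 0 < δ) (hδ1 : δ < 1) (hA : 1 ≤ A)
    (hpA : 18 * d / (Real.exp 1 * δ) * Real.sqrt (r / lam) ≤ A) (hσ : 0 ≤ σ) (hσ1 : σ ≤ 1)
    (hF : ∀ f ∈ lossDiffs P Z fstar lam r, empSq D f ≤ σ ^ 2) :
    rademacher (lossDiffs P Z fstar lam r) D ≤
      chainConst δ * Real.sqrt (A / n) * σ ^ (1 - δ) := by
  classical
  have hn' : (0 : ℝ) < n := by exact_mod_cast hn
  -- Chaining needs a positive radius; at `σ = 0` both sides vanish because `1 - δ > 0`.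
  rcases hσ.eq_or_lt with rfl | hσ0
  · rw [Real.zero_rpow (by linarith), mul_zero]
    exact rademacher_le_of_empSq_le hn D le_rfl hF
  have hfin : (lossDiffs P Z fstar lam r).Finite := by
    rw [lossDiffs_eq_image]
    exact (finite_localTrees hlam).image _
  have h := rademacher_le_chaining hn D hfin.toFinset hδ1 (A := A) (by linarith) hσ0 hσ1
    (fun f hf => hF f (hfin.mem_toFinset.1 hf)) ?_
  · rwa [hfin.coe_toFinset] at h
  intro N hN κ hκ hκ1 hsep
  have hex : ∀ f : Cube d × ℤˣ → ℝ, ∃ g, f ∈ N →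
      g ∈ localTrees P Z lam r ∧ f = lossOf g - lossOf fstar := fun f => by
    by_cases hf : f ∈ N
    · obtain ⟨g, hg⟩ := hfin.mem_toFinset.1 (hN hf)
      exact ⟨g, fun _ => hg⟩
    · exact ⟨fstar, fun h => absurd h hf⟩
  choose G hG using hex
  have hinj : Set.InjOn G N := fun f hf g hg hfg => by
    rw [(hG f hf).2, (hG g hg).2, hfg]
  rw [← Finset.card_image_of_injOn hinj]
  refine log_two_mul_card_le_of_separated (p := ⌊Real.sqrt (r / lam)⌋₊) hd hn
    (fun i => (D i).1) (N.image G) ?_ hκ hκ1 ?_ hδ hδ1 hA ?_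
  · intro g hg
    obtain ⟨f, hf, rfl⟩ := Finset.mem_image.1 hg
    exact isGuillotine_of_mem_localTrees hd hlam (hG f hf).1
  · intro a ha b hb hab
    obtain ⟨f, hf, rfl⟩ := Finset.mem_image.1 ha
    obtain ⟨g, hg, rfl⟩ := Finset.mem_image.1 hb
    have h1 := hsep f hf g hg fun h => hab (by rw [h])
    -- The Bayes loss cancels, so distances in the loss class are disagreement frequencies of trees
    -- and the tree entropy applies.
    have h2 : f - g = lossOf (G f) - lossOf (G g) := by
      conv_lhs => rw [(hG f hf).2, (hG g hg).2]
      abel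
    rw [h2, empSq_lossOf_sub, inv_mul_eq_div, le_div_iff₀ hn'] at h1
    linarith
  · refine le_trans ?_ hpA
    gcongr
    exact Nat.floor_le (Real.sqrt_nonneg _)

end Local

/-! ### The expected Rademacher average -/

section Expectation

variable {d k : ℕ} {P : Measure (Cube d × ℤˣ)} [IsProbabilityMeasure P]
  {Z : Fin k → SplittingPolicy d} {lam r : ℝ} {fstar : Cube d → ℤˣ} {n : ℕ}

theorem integrable_rademacher {S : Type*} [MeasurableSpace S] (μ : Measure (Fin n → S))
    [IsFiniteMeasure μ] {F : Set (S → ℝ)} (hF : F.Finite) (hm : ∀ f ∈ F, Measurable f)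
    (hb : ∀ f ∈ F, ∀ z, |f z| ≤ 1) : Integrable (fun D : Fin n → S => rademacher F D) μ := by
  have := hF.to_subtype
  have hmeas : Measurable fun D : Fin n → S => rademacher F D := by
    unfold rademacher
    refine (Finset.measurable_sum _ fun ε _ => Measurable.iSup fun f : F => ?_).const_mul _
    exact (measurable_signedAvg (hm f f.2) ε).abs
  refine Integrable.of_bound hmeas.aestronglyMeasurable 1 (Filter.Eventually.of_forall fun D => ?_)
  rw [Real.norm_eq_abs, abs_of_nonneg (rademacher_nonneg F D), rademacher_eq,
    ← signMean_const (n := n) 1]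
  refine signMean_mono fun ε => Real.iSup_le (fun f => ?_) zero_le_one
  exact abs_signedAvg_le_one D ε (hb f f.2)

/-- Symmetrization is applied to the squares. A loss difference `h` is in `{0, 1}` where the label
equals `fstar` and in `{-1, 0}` elsewhere, so `h²` is `h` times a sign common to the whole class.
The squares thus have the same Rademacher average as the class, and no contraction factor is lost.
-/
theorem integral_iSup_empSq_le (hn : 0 < n) (hlam : 0 < lam)
    (hne : (localTrees P Z lam r).Nonempty) (hf : IsBayesDecision P fstar) {α : ℝ≥0∞} {c : ℝ}
    (hc : 0 < c) (hP : HasNoiseExponent P α c) (hr : 0 < r) :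
    ∫ D : Fin n → Cube d × ℤˣ, ⨆ h : lossDiffs P Z fstar lam r, empSq D h
        ∂(Measure.pi fun _ => P) ≤
      2 * (2 + c) * r ^ varExponent α +
        2 * ∫ D : Fin n → Cube d × ℤˣ, rademacher (lossDiffs P Z fstar lam r) D
          ∂(Measure.pi fun _ => P) := by
  classical
  have hfin : (lossDiffs P Z fstar lam r).Finite := by
    rw [lossDiffs_eq_image]
    exact (finite_localTrees hlam).image _
  have : Finite (lossDiffs P Z fstar lam r) := hfin.to_subtype
  have : Nonempty (lossDiffs P Z fstar lam r) := by
    rw [lossDiffs_eq_image]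
    exact (hne.image _).to_subtype
  have hmeas : ∀ h : lossDiffs P Z fstar lam r, Measurable h.1 := by
    rintro ⟨h, g, hg, rfl⟩
    exact (measurable_lossOf (measurable_of_mem_treeClass hg.1)).sub (measurable_lossOf hf.1)
  have key := integral_iSup_avg_le hn P (fun (h : lossDiffs P Z fstar lam r) z => h.1 z ^ 2)
    (fun h => (hmeas h).pow_const 2)
    (by
      rintro ⟨h, g, hg, rfl⟩ z
      rw [abs_of_nonneg (sq_nonneg _), sq_le_one_iff_abs_le_one]
      exact abs_lossOf_sub_le_one g fstar z)
    (v := 2 * (2 + c) * r ^ varExponent α)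
    (by
      rintro ⟨h, g, hg, rfl⟩
      exact integral_lossOf_sub_sq_le P (measurable_of_mem_treeClass hg.1) hf hc hP hr
        (excessRisk_le_of_mem_localTrees hlam hg))
  have e1 : ∀ (D : Fin n → Cube d × ℤˣ) (h : lossDiffs P Z fstar lam r),
      signedAvg D 1 (fun z => h.1 z ^ 2) = empSq D h.1 := fun D h => by
    simp [signedAvg, empSq]
  have e2 : ∀ D : Fin n → Cube d × ℤˣ, signMean (fun ε =>
      ⨆ h : lossDiffs P Z fstar lam r, |signedAvg D ε (fun z => h.1 z ^ 2)|) =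
      rademacher (lossDiffs P Z fstar lam r) D := by
    intro D
    rw [rademacher_eq, ← signMean_iSup_sign_mul D (fun h : lossDiffs P Z fstar lam r => h.1)
      (fun z => if z.2 = fstar z.1 then 1 else -1)]
    congr 1
    funext ε
    congr 1
    funext h
    congr 2
    funext z
    obtain ⟨h, g, hg, rfl⟩ := h
    simp only [Pi.sub_apply, lossOf, loss]
    rcases Int.units_eq_one_or (g z.1) with h1 | h1 <;>
    rcases Int.units_eq_one_or (fstar z.1) with h2 | h2 <;>
    rcases Int.units_eq_one_or z.2 with h3 | h3 <;>
    simp [h1, h2, h3]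
  simp only [e1, e2] at key
  exact key

/-- Chaining is used with the sample-dependent radius `√(s D)`, and concavity of `t ↦ t^((1-δ)/2)`
moves the expectation inside. The quantity to be bounded reappears on the right through the
second-moment bound. -/
theorem integral_rademacher_le (hd : 0 < d) (hn : 0 < n) (hlam : 0 < lam)
    (hne : (localTrees P Z lam r).Nonempty) (hf : IsBayesDecision P fstar) {α : ℝ≥0∞} {c : ℝ}
    (hc : 0 < c) (hP : HasNoiseExponent P α c) (hr : 0 < r)
    {δ A : ℝ} (hδ : 0 < δ) (hδ1 : δ < 1) (hA : 1 ≤ A)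
    (hpA : 18 * d / (Real.exp 1 * δ) * Real.sqrt (r / lam) ≤ A) :
    ∫ D : Fin n → Cube d × ℤˣ, rademacher (lossDiffs P Z fstar lam r) D
        ∂(Measure.pi fun _ => P) ≤
      chainConst δ * Real.sqrt (A / n) * (2 * (2 + c) * r ^ varExponent α +
        2 * ∫ D : Fin n → Cube d × ℤˣ, rademacher (lossDiffs P Z fstar lam r) D
          ∂(Measure.pi fun _ => P)) ^
          ((1 - δ) / 2) := by
  have hK := chainConst_pos hδ1
  have hfin : (lossDiffs P Z fstar lam r).Finite := by
    rw [lossDiffs_eq_image]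
    exact (finite_localTrees hlam).image _
  have : Finite (lossDiffs P Z fstar lam r) := hfin.to_subtype
  have : Nonempty (lossDiffs P Z fstar lam r) := by
    rw [lossDiffs_eq_image]
    exact (hne.image _).to_subtype
  have hmeas : ∀ h ∈ lossDiffs P Z fstar lam r, Measurable h := by
    rintro h ⟨g, hg, rfl⟩
    exact (measurable_lossOf (measurable_of_mem_treeClass hg.1)).sub (measurable_lossOf hf.1)
  have hbd : ∀ h ∈ lossDiffs P Z fstar lam r, ∀ z, |h z| ≤ 1 := by
    rintro h ⟨g, hg, rfl⟩ z
    exact abs_lossOf_sub_le_one g fstar z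
  set s : (Fin n → Cube d × ℤˣ) → ℝ := fun D => ⨆ h : lossDiffs P Z fstar lam r, empSq D h with hs
  have hs01 : ∀ D, 0 ≤ s D ∧ s D ≤ 1 := fun D => iSup_mem_Icc_of_bound fun h =>
    ⟨empSq_nonneg D h.1, by
      have hn' : (0 : ℝ) < n := by exact_mod_cast hn
      unfold empSq
      rw [inv_mul_le_iff₀ hn', mul_one]
      calc ∑ i, h.1 (D i) ^ 2 ≤ ∑ _i : Fin n, (1 : ℝ) := Finset.sum_le_sum fun i _ =>
            (sq_le_one_iff_abs_le_one _).2 (hbd h.1 h.2 _)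
        _ = n := by simp⟩
  have hsm : Measurable s := Measurable.iSup fun h =>
    (Finset.measurable_sum _ fun i _ =>
      ((hmeas h.1 h.2).comp (measurable_pi_apply i)).pow_const 2).const_mul _
  set μ : Measure (Fin n → Cube d × ℤˣ) := Measure.pi fun _ => P with hμ
  set β : ℝ := (1 - δ) / 2 with hβ
  have hβ0 : 0 ≤ β := by rw [hβ]; linarith
  have hβ1 : β ≤ 1 := by rw [hβ]; linarith
  have hsint : Integrable s μ := Integrable.of_bound hsm.aestronglyMeasurable 1
    (Filter.Eventually.of_forall fun D => by
      rw [Real.norm_eq_abs, abs_of_nonneg (hs01 D).1]; exact (hs01 D).2)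
  have hsβint : Integrable (fun D => s D ^ β) μ :=
    Integrable.of_bound (hsm.pow_const β).aestronglyMeasurable 1
      (Filter.Eventually.of_forall fun D => by
        rw [Real.norm_eq_abs, abs_of_nonneg (Real.rpow_nonneg (hs01 D).1 _)]
        exact Real.rpow_le_one (hs01 D).1 (hs01 D).2 hβ0)
  have hpt : ∀ D, rademacher (lossDiffs P Z fstar lam r) D ≤
      chainConst δ * Real.sqrt (A / n) * s D ^ β := by
    intro D
    have h := rademacher_lossDiffs_le (P := P) (Z := Z) (fstar := fstar) hd hn hlam D hδ hδ1 hA hpA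
      (σ := Real.sqrt (s D)) (Real.sqrt_nonneg _) (Real.sqrt_le_one.2 (hs01 D).2) (by
        intro f hf
        rw [Real.sq_sqrt (hs01 D).1]
        exact le_ciSup (f := fun h : lossDiffs P Z fstar lam r => empSq D h.1)
          (Set.finite_range _).bddAbove ⟨f, hf⟩)
    rwa [Real.sqrt_eq_rpow (s D), ← Real.rpow_mul (hs01 D).1,
      show 1 / 2 * (1 - δ) = β by rw [hβ]; ring] at h
  have hjensen : ∫ D, s D ^ β ∂μ ≤ (∫ D, s D ∂μ) ^ β :=
    (Real.concaveOn_rpow hβ0 hβ1).le_map_integral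
      (Real.continuous_rpow_const hβ0).continuousOn isClosed_Ici
      (Filter.Eventually.of_forall fun D => (hs01 D).1) hsint hsβint
  calc ∫ D, rademacher (lossDiffs P Z fstar lam r) D ∂μ
      ≤ ∫ D, chainConst δ * Real.sqrt (A / n) * s D ^ β ∂μ :=
        integral_mono (integrable_rademacher μ hfin hmeas hbd) (hsβint.const_mul _) hpt
    _ = chainConst δ * Real.sqrt (A / n) * ∫ D, s D ^ β ∂μ := integral_const_mul _ _
    _ ≤ chainConst δ * Real.sqrt (A / n) * (∫ D, s D ∂μ) ^ β := by gcongr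
    _ ≤ _ := by
        gcongr
        · exact integral_nonneg fun D => (hs01 D).1
        · exact integral_iSup_empSq_le hn hlam hne hf hc hP hr

end Expectation

/-- If `2R ≤ v`, then `v + 2R ≤ 2v` gives the first term. Otherwise `v + 2R ≤ 4R`; dividing by
`R^((1-δ)/2)` and taking the power `2/(1+δ)` gives the second, from which `v` has disappeared. -/
theorem le_max_of_le_mul_rpow {K B v R δ : ℝ} (hK : 0 < K) (hB : 0 < B)
    (hv : 0 ≤ v) (hR : 0 ≤ R) (hδ : 0 < δ) (hδ1 : δ < 1)
    (h : R ≤ K * B ^ (1 / 2 : ℝ) * (v + 2 * R) ^ ((1 - δ) / 2)) :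
    R ≤ max (K * B ^ (1 / 2 : ℝ) * (2 * v) ^ ((1 - δ) / 2))
      ((K * 4 ^ ((1 - δ) / 2)) ^ (2 / (1 + δ)) * B ^ (1 / (1 + δ))) := by
  have hβ : 0 ≤ (1 - δ) / 2 := by linarith
  rcases le_or_gt (2 * R) v with h1 | h1
  · refine le_max_of_le_left (h.trans ?_)
    gcongr
    · linarith
  · refine le_max_of_le_right ?_
    rcases hR.eq_or_lt with rfl | hR0
    · positivity
    have h2 : R ≤ K * B ^ (1 / 2 : ℝ) * (4 * R) ^ ((1 - δ) / 2) := by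
      refine h.trans ?_
      gcongr
      linarith
    rw [Real.mul_rpow (by norm_num) hR] at h2
    have h3 : R ^ ((1 + δ) / 2) ≤ K * 4 ^ ((1 - δ) / 2) * B ^ (1 / 2 : ℝ) := by
      have h4 : R ^ ((1 + δ) / 2) * R ^ ((1 - δ) / 2) = R := by
        rw [← Real.rpow_add hR0, show (1 + δ) / 2 + (1 - δ) / 2 = 1 by ring, Real.rpow_one]
      have h5 := Real.rpow_pos_of_pos hR0 ((1 - δ) / 2)
      refine le_of_mul_le_mul_right ?_ h5
      rw [h4]
      linarith
    have h6 := Real.rpow_le_rpow (by positivity) h3 (show 0 ≤ 2 / (1 + δ) by positivity)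
    rw [← Real.rpow_mul hR, Real.mul_rpow (by positivity) (by positivity),
      ← Real.rpow_mul hB.le] at h6
    have e1 : (1 + δ) / 2 * (2 / (1 + δ)) = 1 := by field_simp
    have e2 : 1 / 2 * (2 / (1 + δ)) = 1 / (1 + δ) := by field_simp
    rwa [e1, e2, Real.rpow_one] at h6

theorem entropyConst_rpow {d : ℕ} {δ : ℝ} (hδ : 0 < δ) (x : ℝ) :
    entropyConst d δ ^ x = (18 * d / (Real.exp 1 * δ)) ^ (x / (2 * δ)) := by
  unfold entropyConst
  rw [← Real.rpow_mul (by positivity)]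
  ring_nf

end BestScoredForest

end

/-! ### Final bound: constants and exponents -/

theorem mainTheorem7 :
    ∃ (c₁ c₂ : ℝ → ℝ) (V : ℝ≥0∞ → ℝ → ℝ),
      (∀ δ : ℝ, 0 < δ → δ < 1 → 0 < c₁ δ ∧ 0 < c₂ δ) ∧
      (∀ (α : ℝ≥0∞) (c : ℝ), 0 < c → 0 < V α c) ∧
      ∀ (d : ℕ) (_ : 0 < d)
        (P : Measure (BestScoredForest.Cube d × ℤˣ)) [IsProbabilityMeasure P]
        (fstar : BestScoredForest.Cube d → ℤˣ)
        (_ : BestScoredForest.IsBayesDecision P fstar)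
        (α : ℝ≥0∞) (c : ℝ) (_ : 0 < c) (_ : BestScoredForest.HasNoiseExponent P α c)
        (ϑ : ℝ) (_ : ϑ = BestScoredForest.varExponent α)
        (k : ℕ) (_ : 0 < k) (Z : Fin k → BestScoredForest.SplittingPolicy d)
        (lam : ℝ) (_ : 0 < lam)
        (r : ℝ) (_ : BestScoredForest.rStar P Z lam < r)
        (δ : ℝ) (_ : 0 < δ) (_ : δ < 1)
        (_ : 1 ≤ BestScoredForest.entropyConst d δ * (r / lam) ^ (1 / (4 * δ)))
        (n : ℕ) (_ : 0 < n),
        Integrable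
            (fun D : Fin n → BestScoredForest.Cube d × ℤˣ =>
              BestScoredForest.rademacher (BestScoredForest.lossDiffs P Z fstar lam r) D)
            (Measure.pi fun _ => P) ∧
          ∫ D : Fin n → BestScoredForest.Cube d × ℤˣ,
              BestScoredForest.rademacher (BestScoredForest.lossDiffs P Z fstar lam r) D
              ∂(Measure.pi fun _ => P) ≤
            max
              (c₁ δ * BestScoredForest.entropyConst d δ ^ δ * V α c ^ ((1 - δ) / 2) *
                lam ^ (-(1 / 4) : ℝ) * r ^ ((2 * ϑ - 2 * ϑ * δ + 1) / 4) *
                (n : ℝ) ^ (-(1 / 2) : ℝ))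
              (c₂ δ * BestScoredForest.entropyConst d δ ^ (2 * δ / (1 + δ)) *
                lam ^ (-(1 / (2 + 2 * δ))) * r ^ (1 / (2 + 2 * δ)) *
                (n : ℝ) ^ (-(1 / (1 + δ)))) := by
  -- `V = 4(2+c)` is twice the variance constant `2(2+c)`, the extra 2 coming from the case `2R ≤
  -- v`.
  refine ⟨BestScoredForest.chainConst,
    fun δ => (BestScoredForest.chainConst δ * 4 ^ ((1 - δ) / 2)) ^ (2 / (1 + δ)),
    fun _ c => 4 * (2 + c), fun δ hδ hδ1 => ?_, fun α c hc => by positivity, ?_⟩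
  · have := BestScoredForest.chainConst_pos hδ1
    exact ⟨this, by positivity⟩
  intro d hd P _ fstar hf α c hc hP ϑ hϑ k hk Z lam hlam r hr δ hδ hδ1 hcond n hn
  have hn' : (0 : ℝ) < n := by exact_mod_cast hn
  have hd' : (0 : ℝ) < d := by exact_mod_cast hd
  have hr0 := BestScoredForest.pos_of_rStar_lt hk hlam hr
  have hne := BestScoredForest.nonempty_localTrees hk hr
  have hK := BestScoredForest.chainConst_pos hδ1
  constructor
  · refine BestScoredForest.integrable_rademacher _ ?_ ?_ ?_
    · rw [BestScoredForest.lossDiffs_eq_image]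
      exact (BestScoredForest.finite_localTrees hlam).image _
    · rintro h ⟨g, hg, rfl⟩
      exact (BestScoredForest.measurable_lossOf
        (BestScoredForest.measurable_of_mem_treeClass hg.1)).sub
        (BestScoredForest.measurable_lossOf hf.1)
    · rintro h ⟨g, hg, rfl⟩ z
      exact BestScoredForest.abs_lossOf_sub_le_one g fstar z
  set b : ℝ := 18 * d / (Real.exp 1 * δ) with hb
  have hb0 : 0 < b := by positivity
  have hx : Real.sqrt (r / lam) = r ^ (1 / 2 : ℝ) * lam ^ (-(1 / 2) : ℝ) := by
    rw [Real.sqrt_eq_rpow, Real.div_rpow hr0.le hlam.le, Real.rpow_neg hlam.le, div_eq_mul_inv]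
  -- This is the hypothesis on `entropyConst` raised to the power `2δ`.
  have hA : 1 ≤ b * Real.sqrt (r / lam) := by
    have h := Real.one_le_rpow hcond (show 0 ≤ 2 * δ by linarith)
    rw [Real.mul_rpow (by unfold BestScoredForest.entropyConst; positivity) (by positivity),
      BestScoredForest.entropyConst_rpow hδ, ← Real.rpow_mul (by positivity),
      div_self (by positivity), Real.rpow_one] at h
    rwa [show 1 / (4 * δ) * (2 * δ) = 1 / 2 by field_simp; norm_num, ← Real.sqrt_eq_rpow] at h
  have hmain := BestScoredForest.integral_rademacher_le hd hn hlam hne hf hc hP hr0 hδ hδ1 hA le_rfl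
  rw [Real.sqrt_eq_rpow (b * Real.sqrt (r / lam) / n)] at hmain
  have hfinal := BestScoredForest.le_max_of_le_mul_rpow hK
    (show 0 < b * Real.sqrt (r / lam) / n by positivity) (by positivity)
    (integral_nonneg fun D => BestScoredForest.rademacher_nonneg _ D) hδ hδ1 hmain
  have hB : ∀ y : ℝ, (b * Real.sqrt (r / lam) / n) ^ y =
      b ^ y * (r ^ (1 / 2 * y) * lam ^ (-(1 / 2) * y)) * (n : ℝ) ^ (-y) := by
    intro y
    rw [Real.div_rpow (by positivity) hn'.le, Real.mul_rpow hb0.le (by positivity), hx,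
      Real.mul_rpow (by positivity) (by positivity), ← Real.rpow_mul hr0.le,
      ← Real.rpow_mul hlam.le, Real.rpow_neg hn'.le, div_eq_mul_inv]
  refine hfinal.trans (max_le_max (le_of_eq ?_) (le_of_eq ?_))
  · rw [hB, BestScoredForest.entropyConst_rpow hδ, ← hϑ,
      show 2 * (2 * (2 + c) * r ^ ϑ) = 4 * (2 + c) * r ^ ϑ by ring,
      Real.mul_rpow (by positivity) (by positivity), ← Real.rpow_mul hr0.le,
      show (2 * ϑ - 2 * ϑ * δ + 1) / 4 = 1 / 2 * (1 / 2) + ϑ * ((1 - δ) / 2) by ring,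
      Real.rpow_add hr0, show δ / (2 * δ) = 1 / 2 by field_simp,
      show -(1 / 2) * (1 / 2) = (-(1 / 4) : ℝ) by norm_num]
    ring
  · rw [hB, BestScoredForest.entropyConst_rpow hδ,
      show 2 * δ / (1 + δ) / (2 * δ) = 1 / (1 + δ) by field_simp,
      show 1 / 2 * (1 / (1 + δ)) = 1 / (2 + 2 * δ) by field_simp,
      show -(1 / 2) * (1 / (1 + δ)) = -(1 / (2 + 2 * δ)) by field_simp]
    ring
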